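/- For $A\in\mathbb C$ let $\Pi_A$ be the curve $w^2=\lambda^4-A\lambda^2+1$. For $\varphi\in\mathbb R$ say that $A$ solves the Boutroux equations for $\varphi$ if $$\operatorname{Im}\, e^{i\varphi}\int_{\mathbf c}\frac{w}{\lambda^2}\,d\lambda=0$$ for every closed $C^1$ cycle $\mathbf c$ on $\Pi_A$ that avoids the points over $\lambda=0$ and $\lambda=\infty$. Then for all real $\varphi\neq0$ with $|\varphi|$ sufficiently small the Boutroux equations for $\varphi$ have a solution. Moreover, let $A_\varphi$ be such a solution for each real $\varphi\ne 0$ with $|\varphi|$ sufficiently small, and let $\pm\lambda_1,\pm\lambda_2$ be the branch points of $w(A_\varphi,\cdot)$, that is, the roots (with multiplicity) of $\lambda^4-A_\varphi\lambda^2+1$, with signs and numbering such that $0\le\operatorname{Re}\lambda_1\le\operatorname{Re}\lambda_2$. Then there are real numbers $\varepsilon_\varphi$, $\theta_\varphi$ such that, as $\varphi\to0$, $\varphi\neq0$, $$\lambda_1=1-\varepsilon_\varphi e^{i\theta_\varphi}+O(\varepsilon_\varphi^2),\qquad \lambda_2=1+\varepsilon_\varphi e^{i\theta_\varphi}+O(\varepsilon_\varphi^2),$$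 where $\varepsilon_\varphi>0$ for all sufficiently small $|\varphi|\ne0$, $\varepsilon_\varphi\to0$ as $\varphi\to0$, $\theta_\varphi\to\pi/4$ as $\varphi\to0^-$, and $\theta_\varphi\to-\pi/4$ as $\varphi\to0^+$. -/

import Mathlib

open Filter Topology Asymptotics

/-- A (closed, continuously differentiable) cycle on the curve `w ^ 2 = lam ^ 4 - A * lam ^ 2 + 1`,
away from the poles `lam = 0` and `lam = ∞` of the differential `w / lam ^ 2 dlam`.
It is parametrized by `ℝ / ℤ`: the map `t ↦ (lam t, w t)` is 1-periodic and takes its values in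
the curve, `lam` is continuously differentiable and `w` is continuous, i.e. `w` is a continuous
choice of the square root along the path. -/
structure CurveCycle (A : ℂ) where
  lam : ℝ → ℂ
  w : ℝ → ℂ
  contDiff_lam : ContDiff ℝ 1 lam
  continuous_w : Continuous w
  periodic_lam : Function.Periodic lam 1
  periodic_w : Function.Periodic w 1
  lam_ne_zero : ∀ t, lam t ≠ 0
  on_curve : ∀ t, w t ^ 2 = lam t ^ 4 - A * lam t ^ 2 + 1

/-- The integral of `w / lam ^ 2 dlam` along a cycle. -/
noncomputable def CurveCycle.integral {A : ℂ} (c : CurveCycle A) : ℂ :=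
  ∫ t in (0 : ℝ)..1, c.w t / c.lam t ^ 2 * deriv c.lam t

/-- `A` solves the Boutroux equations for the angle `φ`: for every cycle `c` on the curve,
the imaginary part of `exp (i φ) ∫_c w / lam ^ 2 dlam` vanishes. -/
def SolvesBoutroux (φ : ℝ) (A : ℂ) : Prop :=
  ∀ c : CurveCycle A, (Complex.exp (φ * Complex.I) * c.integral).im = 0

/-- `± l₁, ± l₂` are the branch points of `w(A, ·)`, i.e. the roots (with multiplicity) of
`z ^ 4 - A * z ^ 2 + 1`, with signs and numbering chosen so that
`0 ≤ Re l₁ ≤ Re l₂`. -/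
def IsBranchPair (A l₁ l₂ : ℂ) : Prop :=
  (∀ z : ℂ, z ^ 4 - A * z ^ 2 + 1 = (z - l₁) * (z + l₁) * ((z - l₂) * (z + l₂))) ∧
    0 ≤ l₁.re ∧ l₁.re ≤ l₂.re

/-! ### The principal square root -/

/-! Write `A = a + 2`, and put `z = λ - 1/λ`, `s = λ + 1/λ`, `v = w/λ`, `η = dλ/λ`. Then `s² = z² +
4`, `v² = z² - a`, `dz = s η`, `ds = z η`, and the differential is `v η`. Everything is done in
these coordinates and in `x = z²`. Conjugation (`SolvesBoutroux.conj`) exchanges `φ` and `-φ`, so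
take `φ < 0`.

Asymptotics. Two cycles suffice: the unit circle in `λ`, with period proportional to `C = ∫ √(4 sin²
+ a)`, and a cycle around two branch points, with period proportional to `i a K(a)`, where `K =
pairIntegral` and `K(0) > 0`. Signs of real and imaginary parts force `Im a > 0` and `Re a ≤ 0`
(`SolvesBoutroux.im_pos`, `SolvesBoutroux.neg_and_re_nonpos`). For `|a| ≥ δ` the ratio `Im C / |C|`
is then bounded below, which contradicts `Im (e^{iφ} C) = 0` for small `φ`; so `a → 0`
(`SolvesBoutroux.norm_lt_of_im_pos`). Now `Re (e^{iφ} a K(a)) = 0` with `e^{iφ} K(a) → K(0) > 0`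
gives `arg a → π/2`. Finally `λ₁ λ₂ = 1` and `(λ₂ - λ₁)² = a`, so `ε = √|a| / 2` and `θ = arg a /
2`, and the midpoint of `λ₁, λ₂` is `1 + O(|a|)`.

Existence. `PeriodConditions` imposes two real equations on `a`. One reads `Re (e^{iφ} a T(a)) = 0`
with `T = tipIntegral`, `T(0) > 0`; inverting `a ↦ a T(a)` near `0` gives a curve of solutions, and
the intermediate value theorem along it solves the other (`exists_periodConditions`).

That the two equations control every cycle is proved without homology, by constructing a
single-valued imaginary part of `e^{iφ}` times the primitive (`imPrimitive`). Two charts, slit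
planes in `x` centred at `x = 0` and `x = -4`, cover everything except `x = a`, and carry explicit
radial primitives. On their overlap the imaginary parts agree: on the component of `-2` by the
condition `base`, on the remaining wedge at `a` by the condition `tip`. At `x = a` the function
vanishes together with `v`, and `hasDerivAt_of_hasDerivAt_off_zeros` extends the derivative formula
to those times. So `Im (e^{iφ} v η)` is the derivative of a periodic function along each cycle. -/

theorem Complex.sqrt_sq_self (z : ℂ) : z.sqrt ^ 2 = z := by
  simp [Complex.sqrt]

theorem Complex.sqrt_ne_zero_of_ne_zero {z : ℂ} (hz : z ≠ 0) : z.sqrt ≠ 0 := fun h => hz <| by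
  rw [← z.sqrt_sq_self, h]; simp

theorem Complex.norm_sqrt_sq (z : ℂ) : ‖z.sqrt‖ ^ 2 = ‖z‖ := by
  rw [← norm_pow, z.sqrt_sq_self]

theorem Complex.norm_sqrt_eq (z : ℂ) : ‖z.sqrt‖ = √‖z‖ := by
  rw [← z.norm_sqrt_sq, Real.sqrt_sq (norm_nonneg _)]

theorem Complex.re_sqrt_nonneg (z : ℂ) : 0 ≤ z.sqrt.re := by
  rw [Complex.sqrt, Complex.cpow_inv_two_re]; positivity

theorem Complex.re_sqrt_pos {z : ℂ} (hz : z ∈ Complex.slitPlane) : 0 < z.sqrt.re := by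
  refine lt_of_le_of_ne z.re_sqrt_nonneg fun h => ?_
  have h2 := z.sqrt_sq_self
  have hre := congrArg Complex.re h2
  have him := congrArg Complex.im h2
  simp only [sq, Complex.mul_re, Complex.mul_im, ← h] at hre him
  rcases Complex.mem_slitPlane_iff.1 hz with h3 | h3
  · nlinarith [sq_nonneg z.sqrt.im]
  · apply h3; rw [← him]; ring

theorem Complex.im_sqrt_pos {z : ℂ} (hz : 0 < z.im) : 0 < z.sqrt.im := by
  have h2 := z.sqrt_sq_self
  have him := congrArg Complex.im h2
  simp only [sq, Complex.mul_im] at him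
  nlinarith [z.re_sqrt_nonneg, Complex.re_sqrt_pos (Complex.mem_slitPlane_iff.2 (.inr hz.ne'))]

theorem Complex.im_sqrt_nonneg {z : ℂ} (hz : 0 ≤ z.im) : 0 ≤ z.sqrt.im := by
  rw [Complex.sqrt, Complex.cpow_inv_two_im_eq_sqrt hz]; positivity

theorem Complex.hasDerivAt_sqrt' {z : ℂ} (hz : z ∈ Complex.slitPlane) :
    HasDerivAt Complex.sqrt (1 / (2 * z.sqrt)) z := by
  have hd := (Complex.hasDerivAt_sqrt hz).differentiableAt.hasDerivAt
  have h1 := hd.pow 2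
  have h2 : HasDerivAt (fun z : ℂ => z.sqrt ^ 2) 1 z := by
    simpa only [Complex.sqrt_sq_self] using hasDerivAt_id' z
  have h3 := h1.unique h2
  have h0 := Complex.sqrt_ne_zero_of_ne_zero (Complex.slitPlane_ne_zero hz)
  refine hd.congr_deriv ?_
  rw [eq_div_iff (by simpa using h0), ← h3]
  push_cast; ring

theorem Complex.measurable_sqrt : Measurable Complex.sqrt := by
  unfold Complex.sqrt; fun_prop

/-! ### Integrals depending on a parameter -/

/-- Tube lemma: a bound on the compact fibre over `x₀` persists, enlarged by `1`, for nearby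
parameters. It supplies the constant dominating function for the next two results. -/
theorem eventually_norm_le_of_continuousAt_uIcc {F : ℂ → ℝ → ℂ} {x₀ : ℂ} {a b : ℝ}
    (hc : ∀ r ∈ Set.uIcc a b, ContinuousAt (Function.uncurry F) (x₀, r)) :
    ∃ C : ℝ, ∀ᶠ x in 𝓝 x₀, ∀ r ∈ Set.uIcc a b, ‖F x r‖ ≤ C := by
  have hcont : ContinuousOn (fun r => F x₀ r) (Set.uIcc a b) := fun r hr => by
    have : ContinuousAt (fun r => Function.uncurry F (x₀, r)) r :=
      ContinuousAt.comp (f := fun r => (x₀, r)) (hc r hr) (by fun_prop)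
    exact this.continuousWithinAt
  obtain ⟨C, hC⟩ := isCompact_uIcc.exists_bound_of_continuousOn hcont
  refine ⟨C + 1, ?_⟩
  refine isCompact_uIcc.eventually_forall_of_forall_eventually fun r hr => ?_
  have h1 : ‖Function.uncurry F (x₀, r)‖ < C + 1 := by
    have := hC r hr
    simp only [Function.uncurry]; linarith
  have := (hc r hr).norm.eventually_lt_const h1
  filter_upwards [this] with p hp using hp.le

theorem continuousAt_intervalIntegral_param {F : ℂ → ℝ → ℂ} {x₀ : ℂ} {a b : ℝ}
    (hm : ∀ x, Measurable (F x))
    (hc : ∀ r ∈ Set.uIcc a b, ContinuousAt (Function.uncurry F) (x₀, r)) :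
    ContinuousAt (fun x => ∫ r in a..b, F x r) x₀ := by
  obtain ⟨C, hC⟩ := eventually_norm_le_of_continuousAt_uIcc hc
  refine intervalIntegral.continuousAt_of_dominated_interval (bound := fun _ => C)
    (Eventually.of_forall fun x => (hm x).aestronglyMeasurable) ?_ intervalIntegrable_const ?_
  · filter_upwards [hC] with x hx
    exact Eventually.of_forall fun r hr => hx r (Set.uIoc_subset_uIcc hr)
  · refine Eventually.of_forall fun r hr => ?_
    exact ContinuousAt.comp (f := fun x => (x, r)) (hc r (Set.uIoc_subset_uIcc hr)) (by fun_prop)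

theorem hasDerivAt_intervalIntegral_param {F F' : ℂ → ℝ → ℂ} {x₀ : ℂ} {a b : ℝ}
    (hm : ∀ x, Measurable (F x)) (hm' : ∀ x, Measurable (F' x))
    (hc : ∀ r ∈ Set.uIcc a b, ContinuousAt (Function.uncurry F') (x₀, r))
    (hc0 : ContinuousOn (F x₀) (Set.uIcc a b))
    (hd : ∀ᶠ x in 𝓝 x₀, ∀ r ∈ Set.uIcc a b, HasDerivAt (fun x => F x r) (F' x r) x) :
    HasDerivAt (fun x => ∫ r in a..b, F x r) (∫ r in a..b, F' x₀ r) x₀ := by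
  obtain ⟨C, hC⟩ := eventually_norm_le_of_continuousAt_uIcc hc
  refine (intervalIntegral.hasDerivAt_integral_of_dominated_loc_of_deriv_le (bound := fun _ => C)
    (s := {x | (∀ r ∈ Set.uIcc a b, ‖F' x r‖ ≤ C) ∧
      ∀ r ∈ Set.uIcc a b, HasDerivAt (fun x => F x r) (F' x r) x}) (hC.and hd)
    (Eventually.of_forall fun x => (hm x).aestronglyMeasurable) hc0.intervalIntegrable
    (hm' x₀).aestronglyMeasurable ?_ intervalIntegrable_const ?_).2
  · exact Eventually.of_forall fun r hr x hx => hx.1 r (Set.uIoc_subset_uIcc hr)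
  · exact Eventually.of_forall fun r hr x hx => hx.2 r (Set.uIoc_subset_uIcc hr)

theorem HasDerivAt.comp_real_complex {f : ℂ → ℂ} {g : ℝ → ℂ} {f' g' : ℂ} {t : ℝ}
    (hf : HasDerivAt f f' (g t)) (hg : HasDerivAt g g' t) :
    HasDerivAt (fun t => f (g t)) (f' * g') t := by
  have := (hf.hasFDerivAt.restrictScalars ℝ).comp_hasDerivAt t hg
  refine this.congr_deriv ?_
  simp [mul_comm]

/-- Radial integration gives a primitive on an open set that is star-shaped about `0`. -/
theorem hasDerivAt_mul_integral_of_starShaped {D : Set ℂ} (hD : IsOpen D)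
    (hstar : ∀ z ∈ D, ∀ r ∈ Set.Icc (0 : ℝ) 1, (r : ℂ) * z ∈ D) {f : ℂ → ℂ}
    (hf : DifferentiableOn ℂ f D) (hm : Measurable f) {z : ℂ} (hz : z ∈ D) :
    HasDerivAt (fun z => z * ∫ r in (0 : ℝ)..1, f (r * z)) (f z) z := by
  have hI : Set.uIcc (0 : ℝ) 1 = Set.Icc 0 1 := Set.uIcc_of_le zero_le_one
  have hder : ContinuousOn (deriv f) D := (hf.deriv hD).continuousOn
  have hfd : ∀ w ∈ D, HasDerivAt f (deriv f w) w := fun w hw =>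
    (hf.differentiableAt (hD.mem_nhds hw)).hasDerivAt
  have h1 : HasDerivAt (fun z => ∫ r in (0 : ℝ)..1, f (r * z))
      (∫ r in (0 : ℝ)..1, r * deriv f (r * z)) z := by
    refine hasDerivAt_intervalIntegral_param (F := fun z r => f (r * z))
      (F' := fun z r => r * deriv f (r * z)) ?_ ?_ ?_ ?_ ?_
    · intro x; exact hm.comp (by fun_prop)
    · intro x
      exact Measurable.mul (by fun_prop) ((measurable_deriv f).comp (by fun_prop))
    · intro r hr
      rw [hI] at hr
      have : ContinuousAt (deriv f) ((fun p : ℂ × ℝ => (p.2 : ℂ) * p.1) (z, r)) :=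
        hder.continuousAt (hD.mem_nhds (hstar z hz r hr))
      have h2 := this.comp (f := fun p : ℂ × ℝ => (p.2 : ℂ) * p.1) (by fun_prop)
      exact ContinuousAt.mul (by fun_prop) h2
    · intro r hr
      rw [hI] at hr
      have := (hfd _ (hstar z hz r hr)).continuousAt
      exact (ContinuousAt.comp (f := fun r : ℝ => (r : ℂ) * z) this (by fun_prop)).continuousWithinAt
    · filter_upwards [hD.mem_nhds hz] with x hx r hr
      rw [hI] at hr
      have := (hfd _ (hstar x hx r hr)).comp x ((hasDerivAt_id' x).const_mul (r : ℂ))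
      simpa [mul_comm, Function.comp_def] using this
  have h2 := (hasDerivAt_id' z).fun_mul h1
  have hpath : ∀ {g : ℂ → ℂ}, ContinuousOn g D →
      ContinuousOn (fun r : ℝ => g (r * z)) (Set.uIcc 0 1) := fun hg =>
    hg.comp (by fun_prop) fun r hr => hstar z hz r (hI ▸ hr)
  have hfc := hpath hf.continuousOn
  have hfc' : ContinuousOn (fun r : ℝ => (r : ℂ) * (deriv f (r * z) * z)) (Set.uIcc 0 1) :=
    ContinuousOn.mul (by fun_prop) ((hpath hder).mul continuousOn_const)
  -- Differentiating under the integral produces exactly this integrand, which is the `r`-derivative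
  -- of `r f(rz)`.
  have hFTC : ∫ r in (0 : ℝ)..1, (f (r * z) + r * (deriv f (r * z) * z)) =
      (1 : ℝ) * f ((1 : ℝ) * z) - (0 : ℝ) * f ((0 : ℝ) * z) := by
    refine intervalIntegral.integral_eq_sub_of_hasDerivAt
      (f := fun r : ℝ => (r : ℂ) * f (r * z)) ?_ ?_
    · intro r hr
      rw [hI] at hr
      have hg : HasDerivAt (fun r : ℝ => (r : ℂ) * z) z r := by
        simpa using (Complex.ofRealCLM.hasDerivAt (x := r)).mul_const z
      have h3 := HasDerivAt.comp_real_complex (g := fun r : ℝ => (r : ℂ) * z)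
        (hfd _ (hstar z hz r hr)) hg
      have h4 := (Complex.ofRealCLM.hasDerivAt (x := r)).fun_mul h3
      simpa using h4
    · exact (hfc.add hfc').intervalIntegrable
  refine h2.congr_deriv ?_
  rw [intervalIntegral.integral_add hfc.intervalIntegrable hfc'.intervalIntegrable] at hFTC
  simp only [Complex.ofReal_one, one_mul, Complex.ofReal_zero, zero_mul, sub_zero] at hFTC
  rw [one_mul, ← hFTC, ← intervalIntegral.integral_const_mul]
  congr 1
  exact intervalIntegral.integral_congr fun r _ => by ring

/-! ### Star-shaped charts -/

/-- The plane slit along the rays `α [1, ∞)` and `β [1, ∞)`. -/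
def chartDomain (α β : ℂ) : Set ℂ :=
  {x | 1 - x / α ∈ Complex.slitPlane ∧ 1 - x / β ∈ Complex.slitPlane}

noncomputable def chartIntegrand (α β x : ℂ) : ℂ :=
  (1 - x / α).sqrt / (1 - x / β).sqrt

/-- The radial primitive of the chart integrand in `ζ` is `ζ` times this mean, which depends on `ζ`
only through `x = ζ²`. -/
noncomputable def chartMean (α β x : ℂ) : ℂ :=
  ∫ r in (0 : ℝ)..1, chartIntegrand α β ((r : ℂ) ^ 2 * x)

/-- The primitive of `v dζ / μ` on the curve `μ ^ 2 = ζ ^ 2 - β`, `v ^ 2 = ζ ^ 2 - α`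
vanishing at `ζ = 0`, over the points with `ζ ^ 2 ∈ chartDomain α β`. -/
noncomputable def chartPrimitive (α β ζ μ v : ℂ) : ℂ :=
  v / μ * ((1 - ζ ^ 2 / β).sqrt / (1 - ζ ^ 2 / α).sqrt) * (ζ * chartMean α β (ζ ^ 2))

theorem isOpen_chartDomain (α β : ℂ) : IsOpen (chartDomain α β) :=
  (Complex.isOpen_slitPlane.preimage (by fun_prop : Continuous fun x : ℂ => 1 - x / α)).inter
    (Complex.isOpen_slitPlane.preimage (by fun_prop : Continuous fun x : ℂ => 1 - x / β))

theorem one_sub_mul_mem_slitPlane {y : ℂ} (hy : 1 - y ∈ Complex.slitPlane) {r : ℝ}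
    (hr : r ∈ Set.Icc (0 : ℝ) 1) : 1 - r * y ∈ Complex.slitPlane := by
  have := Complex.starConvex_one_slitPlane.add_smul_sub_mem hy hr.1 hr.2
  convert this using 1
  simp [Complex.real_smul]
  ring

theorem real_mul_mem_chartDomain {α β x : ℂ} (hx : x ∈ chartDomain α β) {r : ℝ}
    (hr : r ∈ Set.Icc (0 : ℝ) 1) : r * x ∈ chartDomain α β := by
  refine ⟨?_, ?_⟩
  · rw [mul_div_assoc]; exact one_sub_mul_mem_slitPlane hx.1 hr
  · rw [mul_div_assoc]; exact one_sub_mul_mem_slitPlane hx.2 hr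

theorem measurable_chartIntegrand (α β : ℂ) : Measurable (chartIntegrand α β) := by
  unfold chartIntegrand
  exact (Complex.measurable_sqrt.comp (by fun_prop)).div (Complex.measurable_sqrt.comp (by fun_prop))

theorem differentiableOn_chartIntegrand (α β : ℂ) :
    DifferentiableOn ℂ (chartIntegrand α β) (chartDomain α β) := by
  intro x hx
  have h1 := (Complex.differentiableAt_sqrt hx.1).comp x
    (by fun_prop : DifferentiableAt ℂ (fun x : ℂ => 1 - x / α) x)
  have h2 := (Complex.differentiableAt_sqrt hx.2).comp x
    (by fun_prop : DifferentiableAt ℂ (fun x : ℂ => 1 - x / β) x)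
  exact (h1.div h2 (Complex.sqrt_ne_zero_of_ne_zero
    (Complex.slitPlane_ne_zero hx.2))).differentiableWithinAt

theorem hasDerivAt_mul_chartMean {α β ζ : ℂ} (hζ : ζ ^ 2 ∈ chartDomain α β) :
    HasDerivAt (fun ζ => ζ * chartMean α β (ζ ^ 2)) (chartIntegrand α β (ζ ^ 2)) ζ := by
  have := hasDerivAt_mul_integral_of_starShaped (D := {ζ | ζ ^ 2 ∈ chartDomain α β})
    (f := fun ζ => chartIntegrand α β (ζ ^ 2))
    ((isOpen_chartDomain α β).preimage (by fun_prop)) ?_ ?_ ?_ hζ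
  · simpa only [mul_pow, chartMean] using this
  · intro z hz r hr
    have := real_mul_mem_chartDomain hz (r := r ^ 2) ⟨by positivity, pow_le_one₀ hr.1 hr.2⟩
    simpa [mul_pow] using this
  · exact (differentiableOn_chartIntegrand α β).comp (by fun_prop) fun _ h => h
  · exact (measurable_chartIntegrand α β).comp (by fun_prop)

/-- The root in the numerator is allowed to vanish, because the principal root is continuous on the
closed right half-plane. This admits the tip `x = α` of the slit, where the radicand is zero at `r =
1`. -/
theorem continuousAt_chartMean {α β x : ℂ}
    (hα : ∀ r ∈ Set.Icc (0 : ℝ) 1, 0 ≤ (1 - (r : ℂ) ^ 2 * x / α).re ∨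
      (1 - (r : ℂ) ^ 2 * x / α).im ≠ 0) (hβ : 1 - x / β ∈ Complex.slitPlane) :
    ContinuousAt (chartMean α β) x := by
  refine continuousAt_intervalIntegral_param
    (F := fun x r => chartIntegrand α β ((r : ℂ) ^ 2 * x)) (fun x => ?_) fun r hr => ?_
  · exact (measurable_chartIntegrand α β).comp (by fun_prop)
  · rw [Set.uIcc_of_le zero_le_one] at hr
    have h2 : 1 - (r : ℂ) ^ 2 * x / β ∈ Complex.slitPlane := by
      have := one_sub_mul_mem_slitPlane hβ (r := r ^ 2) ⟨by positivity, pow_le_one₀ hr.1 hr.2⟩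
      rw [mul_div_assoc]; simpa using this
    simp only [Function.uncurry_def, chartIntegrand]
    refine ContinuousAt.div ?_ ?_
      (Complex.sqrt_ne_zero_of_ne_zero (Complex.slitPlane_ne_zero h2))
    · exact ContinuousAt.comp (f := fun p : ℂ × ℝ => 1 - (p.2 : ℂ) ^ 2 * p.1 / α)
        (x := (x, r)) (Complex.continuousAt_sqrt (hα r hr)) (by fun_prop)
    · exact ContinuousAt.comp (f := fun p : ℂ × ℝ => 1 - (p.2 : ℂ) ^ 2 * p.1 / β)
        (x := (x, r)) (Complex.differentiableAt_sqrt h2).continuousAt (by fun_prop)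

/-- The values `k t` and `-k t` are separated, so a continuous square root of a nonzero constant is
locally constant. -/
theorem eventually_eq_of_sq_eq {X : Type*} [TopologicalSpace X] {k : X → ℂ} {t : X} {c : ℂ}
    (hk : ContinuousAt k t) (hc : c ≠ 0) (h : ∀ᶠ τ in 𝓝 t, k τ ^ 2 = c) :
    ∀ᶠ τ in 𝓝 t, k τ = k t := by
  have ht := h.self_of_nhds
  have h0 : k t ≠ 0 := by rintro h0; apply hc; rw [← ht, h0]; simp
  have h1 : ∀ᶠ τ in 𝓝 t, k τ ≠ -k t :=
    hk.eventually_ne fun h => h0 (by simpa using self_eq_neg.1 h)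
  filter_upwards [h, h1] with τ h2 h3
  exact (sq_eq_sq_iff_eq_or_eq_neg.1 (h2.trans ht.symm)).resolve_right h3

section

variable {α β : ℂ}

/-- The prefactor compares the actual branches of `v` and `μ` with the principal ones. Being a
square root of `α / β`, it is locally constant along paths and disappears from derivatives. -/
theorem chartPrimitive_coeff_sq (hα : α ≠ 0) (hβ : β ≠ 0) {ζ μ v : ℂ} (hμ : μ ^ 2 = ζ ^ 2 - β)
    (hv : v ^ 2 = ζ ^ 2 - α) (hx : ζ ^ 2 ∈ chartDomain α β) :
    (v / μ * ((1 - ζ ^ 2 / β).sqrt / (1 - ζ ^ 2 / α).sqrt)) ^ 2 = α / β := by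
  have h1 := Complex.slitPlane_ne_zero hx.1
  have h2 := Complex.slitPlane_ne_zero hx.2
  have h3 : ζ ^ 2 - α = -α * (1 - ζ ^ 2 / α) := by field_simp; ring
  have h4 : ζ ^ 2 - β = -β * (1 - ζ ^ 2 / β) := by field_simp; ring
  rw [mul_pow, div_pow, div_pow, hμ, hv, Complex.sqrt_sq_self, Complex.sqrt_sq_self, h3, h4]
  generalize 1 - ζ ^ 2 / β = p at *
  generalize 1 - ζ ^ 2 / α = q at *
  field_simp

theorem chartPrimitive_sq (hα : α ≠ 0) (hβ : β ≠ 0) {ζ μ v : ℂ} (hμ : μ ^ 2 = ζ ^ 2 - β)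
    (hv : v ^ 2 = ζ ^ 2 - α) (hx : ζ ^ 2 ∈ chartDomain α β) :
    chartPrimitive α β ζ μ v ^ 2 = α / β * (ζ ^ 2 * chartMean α β (ζ ^ 2) ^ 2) := by
  rw [chartPrimitive, mul_pow, chartPrimitive_coeff_sq hα hβ hμ hv hx, mul_pow]

theorem chart_ne_zero (hβ : β ≠ 0) {ζ μ : ℂ} (hμ : μ ^ 2 = ζ ^ 2 - β)
    (hx : 1 - ζ ^ 2 / β ∈ Complex.slitPlane) : μ ≠ 0 := by
  rintro rfl
  apply Complex.slitPlane_ne_zero hx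
  have : ζ ^ 2 = β := by linear_combination -hμ
  rw [this, div_self hβ, sub_self]

/-- Along a path on the curve, `chartPrimitive` is a primitive of the differential. -/
theorem hasDerivAt_chartPrimitive (hα : α ≠ 0) (hβ : β ≠ 0) {ζ μ v : ℝ → ℂ} {η : ℂ} {t : ℝ}
    (hζ : HasDerivAt ζ (μ t * η) t) (hμc : ContinuousAt μ t) (hvc : ContinuousAt v t)
    (hμ : ∀ᶠ τ in 𝓝 t, μ τ ^ 2 = ζ τ ^ 2 - β) (hv : ∀ᶠ τ in 𝓝 t, v τ ^ 2 = ζ τ ^ 2 - α)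
    (hx : ζ t ^ 2 ∈ chartDomain α β) :
    HasDerivAt (fun τ => chartPrimitive α β (ζ τ) (μ τ) (v τ)) (v t * η) t := by
  have hζc := hζ.continuousAt
  have hμ0 := chart_ne_zero hβ hμ.self_of_nhds hx.2
  have hs1 := Complex.sqrt_ne_zero_of_ne_zero (Complex.slitPlane_ne_zero hx.1)
  have hs2 := Complex.sqrt_ne_zero_of_ne_zero (Complex.slitPlane_ne_zero hx.2)
  set k : ℝ → ℂ := fun τ =>
    v τ / μ τ * ((1 - ζ τ ^ 2 / β).sqrt / (1 - ζ τ ^ 2 / α).sqrt) with hk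
  have hkc : ContinuousAt k t := by
    refine (hvc.div hμc hμ0).mul (ContinuousAt.div ?_ ?_ hs1)
    · exact ContinuousAt.comp (f := fun τ => 1 - ζ τ ^ 2 / β)
        (Complex.differentiableAt_sqrt hx.2).continuousAt (by fun_prop)
    · exact ContinuousAt.comp (f := fun τ => 1 - ζ τ ^ 2 / α)
        (Complex.differentiableAt_sqrt hx.1).continuousAt (by fun_prop)
  have hxe : ∀ᶠ τ in 𝓝 t, ζ τ ^ 2 ∈ chartDomain α β :=
    (hζc.pow 2).eventually_mem ((isOpen_chartDomain α β).mem_nhds hx)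
  have hke := eventually_eq_of_sq_eq hkc (div_ne_zero hα hβ) (by
    filter_upwards [hμ, hv, hxe] with τ h1 h2 h3 using chartPrimitive_coeff_sq hα hβ h1 h2 h3)
  have hG := ((hasDerivAt_mul_chartMean hx).comp_real_complex hζ).const_mul (k t)
  refine (hG.congr_of_eventuallyEq (hke.mono fun τ hτ => ?_)).congr_deriv ?_
  · simp only [chartPrimitive]
    rw [← hτ]
  · simp only [hk, chartIntegrand]
    generalize (1 - ζ t ^ 2 / β).sqrt = p at *
    generalize (1 - ζ t ^ 2 / α).sqrt = q at *
    field_simp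

end

/-! ### The two charts cover the curve -/

theorem exists_eq_mul_of_one_sub_div_notMem_slitPlane {x γ : ℂ} (hγ : γ ≠ 0)
    (h : 1 - x / γ ∉ Complex.slitPlane) : ∃ ρ : ℝ, 1 ≤ ρ ∧ x = ρ * γ := by
  rw [Complex.mem_slitPlane_iff] at h
  push Not at h
  refine ⟨1 - (1 - x / γ).re, by linarith [h.1], ?_⟩
  have h2 : x / γ = ((1 - (1 - x / γ).re : ℝ) : ℂ) := by
    apply Complex.ext
    · simp
    · have := h.2
      simp only [Complex.sub_im, Complex.one_im, zero_sub, neg_eq_zero] at this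
      simp [this]
  rw [← h2, div_mul_cancel₀ _ hγ]

theorem one_sub_div_notMem_slitPlane {γ : ℂ} (hγ : γ ≠ 0) {ρ : ℝ} (h : 1 ≤ ρ) :
    1 - ρ * γ / γ ∉ Complex.slitPlane := by
  rw [mul_div_cancel_right₀ _ hγ, Complex.mem_slitPlane_iff]
  simp; exact h

/-- The common domain of the charts centred at `x = 0` and at `x = -4`. -/
def overlap (a : ℂ) : Set ℂ :=
  {x | x ∈ chartDomain a (-4) ∧ x + 4 ∈ chartDomain (4 + a) 4}

theorem four_add_ne_zero_of_im_pos {a : ℂ} (ha : 0 < a.im) : 4 + a ≠ 0 := fun h => by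
  have := congrArg Complex.im h
  simp at this; linarith

theorem ne_zero_of_im_pos {a : ℂ} (ha : 0 < a.im) : a ≠ 0 := fun h => by simp [h] at ha

theorem exists_real_coordinates {a : ℂ} (ha : 0 < a.im) (x : ℂ) : ∃ α β : ℝ, x = α * a + β := by
  refine ⟨x.im / a.im, x.re - x.im / a.im * a.re, ?_⟩
  apply Complex.ext
  · simp
  · simp [div_mul_cancel₀ _ ha.ne']

/-- As `a` is not real, `a` and `1` form a real basis of `ℂ`. The four alternatives are the slits:
the ray from `a` away from `0`, the ray from `-4` to `-∞`, the ray from `a` away from `-4`, and the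
ray from `0` to `+∞`. Star-shapedness thereby becomes a matter of real inequalities. -/
theorem mem_overlap_iff {a : ℂ} (ha : 0 < a.im) (α β : ℝ) : (α * a + β : ℂ) ∈ overlap a ↔
    ¬ ((β = 0 ∧ 1 ≤ α) ∨ (α = 0 ∧ β ≤ -4) ∨ (1 ≤ α ∧ β = 4 * (α - 1)) ∨ (α = 0 ∧ 0 ≤ β)) := by
  have h0 := ne_zero_of_im_pos ha
  have h4 := four_add_ne_zero_of_im_pos ha
  have key : ∀ {u v u' v' : ℝ}, (u * a + v : ℂ) = u' * a + v' → u = u' ∧ v = v' := by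
    intro u v u' v' h
    have him := congrArg Complex.im h
    have hre := congrArg Complex.re h
    simp at him hre
    rcases him with him | him
    · subst him; exact ⟨rfl, by linarith⟩
    · exact absurd him ha.ne'
  constructor
  · rintro ⟨⟨h1, h2⟩, h3, h5⟩ (⟨rfl, h⟩ | ⟨rfl, h⟩ | ⟨h, rfl⟩ | ⟨rfl, h⟩)
    · apply one_sub_div_notMem_slitPlane h0 h
      simpa using h1
    · apply one_sub_div_notMem_slitPlane (γ := -4) (by norm_num) (ρ := -β / 4) (by linarith)
      convert h2 using 3
      push_cast; ring
    · apply one_sub_div_notMem_slitPlane h4 h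
      convert h3 using 3
      push_cast; ring
    · apply one_sub_div_notMem_slitPlane (γ := 4) (by norm_num) (ρ := β / 4 + 1) (by linarith)
      convert h5 using 3
      push_cast; ring
  · intro h
    contrapose! h
    have h' : ¬ (((1 - (α * a + β : ℂ) / a ∈ Complex.slitPlane) ∧
      (1 - (α * a + β : ℂ) / (-4) ∈ Complex.slitPlane)) ∧
      (1 - ((α * a + β : ℂ) + 4) / (4 + a) ∈ Complex.slitPlane) ∧
      (1 - ((α * a + β : ℂ) + 4) / 4 ∈ Complex.slitPlane)) := h
    rw [not_and_or, not_and_or, not_and_or] at h'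
    rcases h' with (h | h) | (h | h)
    · obtain ⟨ρ, hρ, h⟩ := exists_eq_mul_of_one_sub_div_notMem_slitPlane h0 h
      obtain ⟨rfl, rfl⟩ := key (u' := ρ) (v' := 0) (by simpa using h)
      exact .inl ⟨rfl, hρ⟩
    · obtain ⟨ρ, hρ, h⟩ := exists_eq_mul_of_one_sub_div_notMem_slitPlane (by norm_num) h
      obtain ⟨rfl, rfl⟩ := key (u' := 0) (v' := -4 * ρ) (by rw [h]; push_cast; ring)
      exact .inr (.inl ⟨rfl, by linarith⟩)
    · obtain ⟨ρ, hρ, h⟩ := exists_eq_mul_of_one_sub_div_notMem_slitPlane h4 h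
      obtain ⟨rfl, rfl⟩ := key (u := α) (v := β) (u' := ρ) (v' := 4 * (ρ - 1)) (by
        push_cast; linear_combination h)
      exact .inr (.inr (.inl ⟨hρ, rfl⟩))
    · obtain ⟨ρ, hρ, h⟩ := exists_eq_mul_of_one_sub_div_notMem_slitPlane (by norm_num) h
      obtain ⟨rfl, rfl⟩ := key (u := α) (v := β) (u' := 0) (v' := 4 * (ρ - 1)) (by
        push_cast; linear_combination h)
      exact .inr (.inr (.inr ⟨rfl, by linarith⟩))

/-- The slits of one chart meet those of the other only at `a`: the real rays are disjoint, the
other two stay in the upper half-plane, and their directions `a` and `4 + a` are independent over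
`ℝ`. -/
theorem mem_chartDomain_or {a : ℂ} (ha : 0 < a.im) {x : ℂ} (hx : x ≠ a) :
    x ∈ chartDomain a (-4) ∨ x + 4 ∈ chartDomain (4 + a) 4 := by
  have h0 := ne_zero_of_im_pos ha
  have h4 := four_add_ne_zero_of_im_pos ha
  by_contra! h
  obtain ⟨h1, h2⟩ := h
  rw [chartDomain, Set.mem_ofPred_eq, not_and_or] at h1 h2
  have e1 : ∃ ρ : ℝ, 1 ≤ ρ ∧ (x = ρ * a ∨ x = ρ * (-4)) := by
    rcases h1 with h | h
    · obtain ⟨ρ, hρ, h⟩ := exists_eq_mul_of_one_sub_div_notMem_slitPlane h0 h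
      exact ⟨ρ, hρ, .inl h⟩
    · obtain ⟨ρ, hρ, h⟩ := exists_eq_mul_of_one_sub_div_notMem_slitPlane (by norm_num) h
      exact ⟨ρ, hρ, .inr h⟩
  have e2 : ∃ ρ : ℝ, 1 ≤ ρ ∧ (x + 4 = ρ * (4 + a) ∨ x + 4 = ρ * 4) := by
    rcases h2 with h | h
    · obtain ⟨ρ, hρ, h⟩ := exists_eq_mul_of_one_sub_div_notMem_slitPlane h4 h
      exact ⟨ρ, hρ, .inl h⟩
    · obtain ⟨ρ, hρ, h⟩ := exists_eq_mul_of_one_sub_div_notMem_slitPlane (by norm_num) h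
      exact ⟨ρ, hρ, .inr h⟩
  obtain ⟨ρ, hρ, e1⟩ := e1
  obtain ⟨σ, hσ, e2⟩ := e2
  rcases e1 with rfl | rfl <;> rcases e2 with e | e <;>
    have him := congrArg Complex.im e <;> have hre := congrArg Complex.re e <;>
    simp at him hre
  · rcases him with him | him
    · subst him
      apply hx
      have : ρ = 1 := by nlinarith
      simp [this]
    · exact ha.ne' him
  · rcases him with him | him
    · linarith
    · exact ha.ne' him
  · rcases him with him | him
    · linarith
    · exact ha.ne' him
  · linarith

/-- Outside the wedge at `a` spanned by the two slits, the overlap is star-shaped about `-2`. -/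
theorem segment_mem_overlap_of_not_wedge {a : ℂ} (ha : 0 < a.im) {α β : ℝ} (hx : (α * a + β : ℂ) ∈ overlap a)
    (hw : ¬ (1 < α ∧ 0 < β ∧ β < 4 * (α - 1))) {r : ℝ} (hr : r ∈ Set.Icc (0 : ℝ) 1) :
    (-2 + r * ((α * a + β) - (-2)) : ℂ) ∈ overlap a := by
  have e : (-2 + r * ((α * a + β) - (-2)) : ℂ) =
      ((r * α : ℝ) : ℂ) * a + ((r * (β + 2) - 2 : ℝ) : ℂ) := by push_cast; ring
  rw [e, mem_overlap_iff ha]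
  rw [mem_overlap_iff ha] at hx
  push Not at hx hw
  obtain ⟨h1, h2, h3, h4⟩ := hx
  obtain ⟨r0, r1⟩ := hr
  rcases r0.eq_or_lt with rfl | r0
  · rintro (⟨h, -⟩ | ⟨-, h⟩ | ⟨h, -⟩ | ⟨-, h⟩) <;> norm_num at h
  have hA : 1 ≤ r * α → 1 ≤ α := fun h => by nlinarith
  -- Beyond `α = 1`, a point off the slits and off the wedge has `β < 0` or `β > 4 (α - 1)`. Both
  -- inequalities survive contraction towards `-2`, so the segment misses the two slits issuing from
  -- `a`.
  have hB : 1 ≤ r * α → r * (β + 2) - 2 < 0 ∨ 4 * (r * α - 1) < r * (β + 2) - 2 := by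
    intro h
    have hα := hA h
    rcases lt_trichotomy β 0 with hβ | hβ | hβ
    · left; nlinarith
    · exact absurd hα (not_le.2 (h1 hβ))
    · right
      rcases hα.eq_or_lt with rfl | hα'
      · nlinarith
      · have := lt_of_le_of_ne (hw hα' hβ) (Ne.symm (h3 hα))
        nlinarith
  rintro (⟨h, h'⟩ | ⟨h, h'⟩ | ⟨h, h'⟩ | ⟨h, h'⟩)
  · rcases hB h' with h5 | h5 <;> linarith
  · have : α = 0 := by
      rcases mul_eq_zero.1 h with h | h
      · exact absurd h r0.ne'
      · exact h
    have := h2 this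
    nlinarith
  · rcases hB h with h5 | h5 <;> linarith
  · have : α = 0 := by
      rcases mul_eq_zero.1 h with h | h
      · exact absurd h r0.ne'
      · exact h
    have := h4 this
    nlinarith

/-- The wedge is a cone with vertex `a`, cut off from `-2` by its bounding slits. The comparison
there must start from the vertex, which itself is not in the overlap; hence `0 < r`. -/
theorem segment_mem_overlap_of_wedge {a : ℂ} (ha : 0 < a.im) {α β : ℝ} (hw : 1 < α ∧ 0 < β ∧ β < 4 * (α - 1)) {r : ℝ}
    (hr : 0 < r) : (a + r * ((α * a + β) - a) : ℂ) ∈ overlap a := by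
  have e : (a + r * ((α * a + β) - a) : ℂ) =
      ((1 + r * (α - 1) : ℝ) : ℂ) * a + ((r * β : ℝ) : ℂ) := by push_cast; ring
  obtain ⟨h1, h2, h3⟩ := hw
  have h4 : 0 < r * (α - 1) := mul_pos hr (by linarith)
  have h5 : 0 < r * β := mul_pos hr h2
  rw [e, mem_overlap_iff ha]
  rintro (⟨h, h'⟩ | ⟨h, h'⟩ | ⟨h, h'⟩ | ⟨h, h'⟩) <;> nlinarith

/-! ### Gluing the charts -/

/-- `(Im (exp (i φ) y)) ^ 2` as a function of `w = y ^ 2`. -/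
noncomputable def imSq (φ : ℝ) (w : ℂ) : ℝ :=
  (‖w‖ - (Complex.exp (φ * Complex.I) ^ 2 * w).re) / 2

/-- Since `(Im u)² = (|u|² - Re u²) / 2`, the square of the imaginary part only sees `y²`, and the
sign ambiguity of the primitives drops out. -/
theorem im_exp_mul_sq (φ : ℝ) (y : ℂ) :
    (Complex.exp (φ * Complex.I) * y).im ^ 2 = imSq φ (y ^ 2) := by
  have h1 : ‖y ^ 2‖ = ‖Complex.exp (φ * Complex.I) * y‖ ^ 2 := by
    rw [norm_mul, Complex.norm_exp_ofReal_mul_I, one_mul, norm_pow]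
  have h2 : (Complex.exp (φ * Complex.I) ^ 2 * y ^ 2).re =
      (Complex.exp (φ * Complex.I) * y).re ^ 2 - (Complex.exp (φ * Complex.I) * y).im ^ 2 := by
    rw [← mul_pow, sq, Complex.mul_re]; ring
  rw [imSq, h1, h2, Complex.sq_norm, Complex.normSq_apply]
  ring

theorem continuous_imSq (φ : ℝ) : Continuous (imSq φ) := by
  unfold imSq; fun_prop

theorem chartPrimitive_neg_left (α β ζ μ v : ℂ) :
    chartPrimitive α β (-ζ) μ v = -chartPrimitive α β ζ μ v := by
  simp [chartPrimitive]

theorem chartPrimitive_neg_mid (α β ζ μ v : ℂ) :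
    chartPrimitive α β ζ (-μ) v = -chartPrimitive α β ζ μ v := by
  simp [chartPrimitive, div_neg]

theorem chartPrimitive_neg_right (α β ζ μ v : ℂ) :
    chartPrimitive α β ζ μ (-v) = -chartPrimitive α β ζ μ v := by
  simp [chartPrimitive, neg_div]

/-- The difference of the primitives coming from the two charts. -/
noncomputable def chartDifference (a z s v : ℂ) : ℂ :=
  chartPrimitive a (-4) z s v - chartPrimitive (4 + a) 4 s z v

/-- Both primitives are odd in each of `z`, `s`, `v`, so another point over the same `x` changes the
difference at most by a sign. One choice of roots per `x` is therefore enough. -/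
theorem chartDifference_eq_or_eq_neg {a z s v z' s' v' : ℂ} (hz : z' ^ 2 = z ^ 2)
    (hs : s' ^ 2 = s ^ 2) (hv : v' ^ 2 = v ^ 2) :
    chartDifference a z' s' v' = chartDifference a z s v ∨
      chartDifference a z' s' v' = -chartDifference a z s v := by
  rcases sq_eq_sq_iff_eq_or_eq_neg.1 hz with rfl | rfl <;>
  rcases sq_eq_sq_iff_eq_or_eq_neg.1 hs with rfl | rfl <;>
  rcases sq_eq_sq_iff_eq_or_eq_neg.1 hv with rfl | rfl <;>
  simp [chartDifference, chartPrimitive_neg_left, chartPrimitive_neg_mid,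
    chartPrimitive_neg_right, add_comm, sub_eq_add_neg]

theorem im_mul_chartDifference_eq_zero {c a z s v z' s' v' : ℂ} (hz : z' ^ 2 = z ^ 2)
    (hs : s' ^ 2 = s ^ 2) (hv : v' ^ 2 = v ^ 2) (h : (c * chartDifference a z s v).im = 0) :
    (c * chartDifference a z' s' v').im = 0 := by
  rcases chartDifference_eq_or_eq_neg (a := a) hz hs hv with h1 | h1 <;> rw [h1]
  · exact h
  · rw [mul_neg, Complex.neg_im, h, neg_zero]

theorem hasDerivAt_chartPrimitive_left {a : ℂ} (ha : 0 < a.im) {z s v : ℝ → ℂ} {η : ℂ} {t : ℝ}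
    (hz : HasDerivAt z (s t * η) t) (hs : HasDerivAt s (z t * η) t) (hv : ContinuousAt v t)
    (e1 : ∀ᶠ τ in 𝓝 t, s τ ^ 2 = z τ ^ 2 + 4) (e2 : ∀ᶠ τ in 𝓝 t, v τ ^ 2 = z τ ^ 2 - a)
    (hx : z t ^ 2 ∈ chartDomain a (-4)) :
    HasDerivAt (fun τ => chartPrimitive a (-4) (z τ) (s τ) (v τ)) (v t * η) t :=
  hasDerivAt_chartPrimitive (ne_zero_of_im_pos ha) (by norm_num) hz hs.continuousAt hv
    (e1.mono fun τ h => by linear_combination h) e2 hx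

theorem hasDerivAt_chartPrimitive_right {a : ℂ} (ha : 0 < a.im) {z s v : ℝ → ℂ} {η : ℂ} {t : ℝ}
    (hz : HasDerivAt z (s t * η) t) (hs : HasDerivAt s (z t * η) t) (hv : ContinuousAt v t)
    (e1 : ∀ᶠ τ in 𝓝 t, s τ ^ 2 = z τ ^ 2 + 4) (e2 : ∀ᶠ τ in 𝓝 t, v τ ^ 2 = z τ ^ 2 - a)
    (hx : z t ^ 2 + 4 ∈ chartDomain (4 + a) 4) :
    HasDerivAt (fun τ => chartPrimitive (4 + a) 4 (s τ) (z τ) (v τ)) (v t * η) t :=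
  hasDerivAt_chartPrimitive (four_add_ne_zero_of_im_pos ha) (by norm_num) hs hz.continuousAt hv
    (e1.mono fun τ h => by linear_combination -h)
    ((e1.and e2).mono fun τ h => by linear_combination h.2 - h.1) (by rwa [e1.self_of_nhds])

/-- Over the overlap of the charts the three square roots have holomorphic branches. -/
noncomputable def overlapZ (x : ℂ) : ℂ := 2 * Complex.I * (1 - (x + 4) / 4).sqrt

noncomputable def overlapS (x : ℂ) : ℂ := 2 * (1 - x / (-4)).sqrt

noncomputable def overlapV (a x : ℂ) : ℂ := (-a).sqrt * (1 - x / a).sqrt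

theorem overlapZ_sq (x : ℂ) : overlapZ x ^ 2 = x := by
  rw [overlapZ, mul_pow, mul_pow, Complex.sqrt_sq_self, Complex.I_sq]; ring

theorem overlapS_sq (x : ℂ) : overlapS x ^ 2 = x + 4 := by
  rw [overlapS, mul_pow, Complex.sqrt_sq_self]; ring

theorem overlapV_sq {a : ℂ} (ha : a ≠ 0) (x : ℂ) : overlapV a x ^ 2 = x - a := by
  rw [overlapV, mul_pow, Complex.sqrt_sq_self, Complex.sqrt_sq_self]; field_simp; ring

theorem HasDerivAt.of_sq_eq {f g : ℝ → ℂ} {g' : ℂ} {t : ℝ} (hf : DifferentiableAt ℝ f t)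
    (hg : HasDerivAt g g' t) (h : ∀ τ, f τ ^ 2 = g τ) (h0 : f t ≠ 0) :
    HasDerivAt f (g' / (2 * f t)) t := by
  have h1 := (hf.hasDerivAt.fun_pow 2)
  have h2 := h1.unique (hg.congr_of_eventuallyEq (Eventually.of_forall h))
  refine hf.hasDerivAt.congr_deriv ?_
  rw [eq_div_iff (by simpa using h0), ← h2]
  push_cast; ring

/-- The difference of the two primitives is constant along segments in the overlap. -/
theorem hasDerivAt_chartDifference {a : ℂ} (ha : 0 < a.im) (x₀ d : ℂ) {r : ℝ}
    (hr : x₀ + r * d ∈ overlap a) :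
    HasDerivAt (fun r : ℝ => chartDifference a (overlapZ (x₀ + r * d)) (overlapS (x₀ + r * d))
      (overlapV a (x₀ + r * d))) 0 r := by
  have ha0 := ne_zero_of_im_pos ha
  have hp : HasDerivAt (fun r : ℝ => x₀ + r * d) d r := by
    simpa using ((Complex.ofRealCLM.hasDerivAt (x := r)).mul_const d).const_add x₀
  have hsq : ∀ {f : ℂ → ℂ}, DifferentiableAt ℂ f (x₀ + r * d) →
      f (x₀ + r * d) ∈ Complex.slitPlane →
      DifferentiableAt ℝ (fun r : ℝ => (f (x₀ + r * d)).sqrt) r := by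
    intro f hf hf'
    exact (HasDerivAt.comp_real_complex (g := fun r : ℝ => x₀ + r * d)
      ((Complex.hasDerivAt_sqrt' hf').comp _ hf.hasDerivAt) hp).differentiableAt
  have hzd : DifferentiableAt ℝ (fun r : ℝ => overlapZ (x₀ + r * d)) r :=
    (hsq (f := fun x => 1 - (x + 4) / 4) (by fun_prop) hr.2.2).const_mul _
  have hsd : DifferentiableAt ℝ (fun r : ℝ => overlapS (x₀ + r * d)) r :=
    (hsq (f := fun x => 1 - x / (-4)) (by fun_prop) hr.1.2).const_mul _
  have hvd : DifferentiableAt ℝ (fun r : ℝ => overlapV a (x₀ + r * d)) r :=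
    (hsq (f := fun x => 1 - x / a) (by fun_prop) hr.1.1).const_mul _
  have hz0 : overlapZ (x₀ + r * d) ≠ 0 := by
    simpa [overlapZ] using
      Complex.sqrt_ne_zero_of_ne_zero (Complex.slitPlane_ne_zero hr.2.2)
  have hs0 : overlapS (x₀ + r * d) ≠ 0 :=
    mul_ne_zero two_ne_zero (Complex.sqrt_ne_zero_of_ne_zero (Complex.slitPlane_ne_zero hr.1.2))
  have hz := HasDerivAt.of_sq_eq hzd hp (fun τ => overlapZ_sq _) hz0
  have hs := HasDerivAt.of_sq_eq hsd (hp.add_const 4) (fun τ => overlapS_sq _) hs0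
  -- From `dx = 2 z dz` and `dz = s η`.
  set η := d / (2 * overlapZ (x₀ + r * d) * overlapS (x₀ + r * d)) with hη
  have hz' := hz.congr_deriv (show _ = overlapS (x₀ + r * d) * η by
    rw [hη]; generalize overlapZ _ = p at *; generalize overlapS _ = q at *; field_simp)
  have hs' := hs.congr_deriv (show _ = overlapZ (x₀ + r * d) * η by
    rw [hη]; generalize overlapZ _ = p at *; generalize overlapS _ = q at *; field_simp)
  have e1 : ∀ᶠ τ : ℝ in 𝓝 r, overlapS (x₀ + τ * d) ^ 2 = overlapZ (x₀ + τ * d) ^ 2 + 4 :=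
    Eventually.of_forall fun τ => by rw [overlapZ_sq, overlapS_sq]
  have e2 : ∀ᶠ τ : ℝ in 𝓝 r, overlapV a (x₀ + τ * d) ^ 2 = overlapZ (x₀ + τ * d) ^ 2 - a :=
    Eventually.of_forall fun τ => by rw [overlapZ_sq, overlapV_sq ha0]
  have H1 := hasDerivAt_chartPrimitive_left ha hz' hs' hvd.continuousAt e1 e2
    (by rw [overlapZ_sq]; exact hr.1)
  have H2 := hasDerivAt_chartPrimitive_right ha hz' hs' hvd.continuousAt e1 e2
    (by rw [overlapZ_sq]; exact hr.2)
  simpa [chartDifference] using H1.fun_sub H2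

theorem chartDifference_segment_eq {a : ℂ} (ha : 0 < a.im) (x₀ d : ℂ) {r₀ r₁ : ℝ} (hr : r₀ ≤ r₁)
    (h : ∀ r ∈ Set.Icc r₀ r₁, x₀ + r * d ∈ overlap a) :
    chartDifference a (overlapZ (x₀ + r₁ * d)) (overlapS (x₀ + r₁ * d))
      (overlapV a (x₀ + r₁ * d)) =
    chartDifference a (overlapZ (x₀ + r₀ * d)) (overlapS (x₀ + r₀ * d))
      (overlapV a (x₀ + r₀ * d)) := by
  have hd := fun r hr => hasDerivAt_chartDifference ha x₀ d (h r hr)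
  exact constant_of_derivWithin_zero (f := fun r : ℝ => chartDifference a
    (overlapZ (x₀ + r * d)) (overlapS (x₀ + r * d)) (overlapV a (x₀ + r * d)))
    (fun r hr => (hd r hr).differentiableAt.differentiableWithinAt)
    (fun r hr' => by
      have hr2 : r₀ < r₁ := hr'.1.trans_lt hr'.2
      exact (hd r ⟨hr'.1, hr'.2.le⟩).hasDerivWithinAt.derivWithin
        (uniqueDiffOn_Icc hr2 r ⟨hr'.1, hr'.2.le⟩)) r₁ ⟨hr, le_rfl⟩

/-- Comparison of the charts at `x = -2`, along the unit circle. -/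
theorem chartDifference_base {a : ℂ} (ha : 0 < a.im) {c : ℂ}
    (hP : (c * ∫ τ in (0 : ℝ)..(Real.pi / 2), (4 * (Real.sin τ : ℂ) ^ 2 + a).sqrt).im = 0) :
    (c * chartDifference a (overlapZ (-2)) (overlapS (-2)) (overlapV a (-2))).im = 0 := by
  have ha0 := ne_zero_of_im_pos ha
  have hpi := Real.pi_pos
  set z : ℝ → ℂ := fun τ => 2 * Complex.I * (Real.sin τ : ℂ) with hz
  set s : ℝ → ℂ := fun τ => 2 * (Real.cos τ : ℂ) with hs
  set v : ℝ → ℂ := fun τ => Complex.I * (4 * (Real.sin τ : ℂ) ^ 2 + a).sqrt with hv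
  have hdz : ∀ τ, HasDerivAt z (s τ * Complex.I) τ := fun τ => by
    have := ((Real.hasDerivAt_sin τ).ofReal_comp).const_mul (2 * Complex.I)
    exact this.congr_deriv (by simp only [hs]; ring)
  have hds : ∀ τ, HasDerivAt s (z τ * Complex.I) τ := fun τ => by
    have := ((Real.hasDerivAt_cos τ).ofReal_comp).const_mul 2
    exact this.congr_deriv (by
      simp only [hz, Complex.ofReal_neg]
      linear_combination (-2 * (Real.sin τ : ℂ)) * Complex.I_sq)
  have him : ∀ τ : ℝ, (4 * (Real.sin τ : ℂ) ^ 2 + a).im = a.im := fun τ => by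
    have : (4 * (Real.sin τ : ℂ) ^ 2 + a) = ((4 * Real.sin τ ^ 2 : ℝ) : ℂ) + a := by push_cast; ring
    rw [this, Complex.add_im, Complex.ofReal_im, zero_add]
  have hcv : Continuous v := by
    refine continuous_const.mul (continuous_iff_continuousAt.2 fun τ => ?_)
    refine ContinuousAt.comp (f := fun τ : ℝ => 4 * (Real.sin τ : ℂ) ^ 2 + a)
      (Complex.continuousAt_sqrt (.inr (by rw [him]; exact ha.ne'))) (by fun_prop)
  have hcs : ∀ τ : ℝ, (Real.cos τ : ℂ) ^ 2 = 1 - (Real.sin τ : ℂ) ^ 2 := fun τ => by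
    rw [← Complex.ofReal_pow, Real.cos_sq']; push_cast; rfl
  have e1 : ∀ τ, s τ ^ 2 = z τ ^ 2 + 4 := fun τ => by
    simp only [hz, hs, mul_pow, hcs, Complex.I_sq]; ring
  have e2 : ∀ τ, v τ ^ 2 = z τ ^ 2 - a := fun τ => by
    simp only [hz, hv, mul_pow, Complex.I_sq, Complex.sqrt_sq_self]; ring
  have hzr : ∀ τ : ℝ, z τ ^ 2 = ((-4 * Real.sin τ ^ 2 : ℝ) : ℂ) := fun τ => by
    simp only [hz, mul_pow, Complex.I_sq]; push_cast; ring
  have hnr : ∀ {γ : ℂ}, γ.im ≠ 0 → ∀ y : ℝ, 1 - (y : ℂ) / γ ∈ Complex.slitPlane := by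
    intro γ hγ y
    by_contra hn
    have hγ0 : γ ≠ 0 := by rintro rfl; simp at hγ
    obtain ⟨ρ, hρ, h⟩ := exists_eq_mul_of_one_sub_div_notMem_slitPlane hγ0 hn
    have := congrArg Complex.im h
    simp at this
    rcases this with h | h
    · linarith
    · exact hγ h
  have hd1 : ∀ τ ∈ Set.Icc 0 (Real.pi / 4), z τ ^ 2 ∈ chartDomain a (-4) := by
    intro τ hτ
    refine ⟨by rw [hzr]; exact hnr ha.ne' _, ?_⟩
    have hc : 0 < Real.cos τ := Real.cos_pos_of_mem_Ioo ⟨by linarith [hτ.1], by linarith [hτ.2]⟩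
    have : 1 - z τ ^ 2 / (-4) = ((Real.cos τ ^ 2 : ℝ) : ℂ) := by
      rw [hzr, Real.cos_sq']; push_cast; ring
    rw [this, Complex.ofReal_mem_slitPlane]; positivity
  have hd2 : ∀ τ ∈ Set.Icc (Real.pi / 4) (Real.pi / 2), z τ ^ 2 + 4 ∈ chartDomain (4 + a) 4 := by
    intro τ hτ
    refine ⟨?_, ?_⟩
    · have := hnr (γ := 4 + a) (by simpa using ha.ne') (-4 * Real.sin τ ^ 2 + 4)
      rw [hzr]
      convert this using 3
      push_cast; ring
    · have hc : 0 < Real.sin τ := Real.sin_pos_of_pos_of_lt_pi (by linarith [hτ.1]) (by linarith [hτ.2])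
      have : 1 - (z τ ^ 2 + 4) / 4 = ((Real.sin τ ^ 2 : ℝ) : ℂ) := by
        rw [hzr]; push_cast; ring
      rw [this, Complex.ofReal_mem_slitPlane]; positivity
  have hint : ∀ x y, IntervalIntegrable (fun τ => v τ * Complex.I) MeasureTheory.volume x y :=
    fun x y => (hcv.mul continuous_const).intervalIntegrable _ _
  have I1 := intervalIntegral.integral_eq_sub_of_hasDerivAt (a := 0) (b := Real.pi / 4)
    (fun τ hτ => hasDerivAt_chartPrimitive_left ha (hdz τ) (hds τ) hcv.continuousAt
      (Eventually.of_forall e1) (Eventually.of_forall e2)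
      (hd1 τ (by rwa [Set.uIcc_of_le (by positivity)] at hτ))) (hint _ _)
  have I2 := intervalIntegral.integral_eq_sub_of_hasDerivAt (a := Real.pi / 4) (b := Real.pi / 2)
    (fun τ hτ => hasDerivAt_chartPrimitive_right ha (hdz τ) (hds τ) hcv.continuousAt
      (Eventually.of_forall e1) (Eventually.of_forall e2)
      (hd2 τ (by rwa [Set.uIcc_of_le (by linarith)] at hτ))) (hint _ _)
  have z0 : z 0 = 0 := by simp [hz]
  have s0 : s (Real.pi / 2) = 0 := by simp [hs]
  have hb1 : chartPrimitive a (-4) (z 0) (s 0) (v 0) = 0 := by rw [z0]; simp [chartPrimitive]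
  have hb2 : chartPrimitive (4 + a) 4 (s (Real.pi / 2)) (z (Real.pi / 2)) (v (Real.pi / 2)) = 0 := by
    rw [s0]; simp [chartPrimitive]
  rw [hb1, sub_zero] at I1
  rw [hb2, zero_sub] at I2
  -- On the circle `λ = e^{iτ}` the chart centres are `τ = 0` (`z = 0`) and `τ = π/2` (`s = 0`).
  -- Integrating from each centre to `τ = π/4`, where `x = -2`, makes the difference the integral
  -- over the whole quarter circle.
  have hD : chartDifference a (z (Real.pi / 4)) (s (Real.pi / 4)) (v (Real.pi / 4)) =
      -∫ τ in (0 : ℝ)..(Real.pi / 2), (4 * (Real.sin τ : ℂ) ^ 2 + a).sqrt := by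
    rw [chartDifference, ← I1, sub_eq_add_neg, ← I2,
      intervalIntegral.integral_add_adjacent_intervals (hint _ _) (hint _ _),
      ← intervalIntegral.integral_neg]
    refine intervalIntegral.integral_congr fun τ _ => ?_
    simp only [hv]
    linear_combination (4 * (Real.sin τ : ℂ) ^ 2 + a).sqrt * Complex.I_sq
  have hx : z (Real.pi / 4) ^ 2 = -2 := by
    rw [hzr, Real.sin_pi_div_four, div_pow, Real.sq_sqrt (by norm_num)]; norm_num
  refine im_mul_chartDifference_eq_zero (z := z (Real.pi / 4)) (s := s (Real.pi / 4))
    (v := v (Real.pi / 4)) ?_ ?_ ?_ ?_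
  · rw [overlapZ_sq, hx]
  · rw [overlapS_sq, e1, hx]
  · rw [overlapV_sq ha0, e2, hx]
  · rw [hD, mul_neg, Complex.neg_im, hP, neg_zero]

/-! ### Single-valuedness of the imaginary part of the primitive -/

/-- The square of the imaginary part of `exp (i φ)` times the primitive, as a function of
`x = ζ ^ 2`. -/
noncomputable def chartImSq (φ : ℝ) (α β x : ℂ) : ℝ :=
  imSq φ (α / β * (x * chartMean α β x ^ 2))

theorem im_chartPrimitive_sq (φ : ℝ) {α β : ℂ} (hα : α ≠ 0) (hβ : β ≠ 0) {ζ μ v : ℂ}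
    (hμ : μ ^ 2 = ζ ^ 2 - β) (hv : v ^ 2 = ζ ^ 2 - α) (hx : ζ ^ 2 ∈ chartDomain α β) :
    (Complex.exp (φ * Complex.I) * chartPrimitive α β ζ μ v).im ^ 2 = chartImSq φ α β (ζ ^ 2) := by
  rw [im_exp_mul_sq, chartPrimitive_sq hα hβ hμ hv hx, chartImSq]

theorem continuousAt_chartImSq (φ : ℝ) {α β : ℂ} (hα : α ≠ 0)
    (hβ : 1 - α / β ∈ Complex.slitPlane) : ContinuousAt (chartImSq φ α β) α := by
  have h : ContinuousAt (chartMean α β) α := by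
    refine continuousAt_chartMean (fun r hr => .inl ?_) hβ
    rw [mul_div_cancel_right₀ _ hα]
    have : r ^ 2 ≤ 1 := pow_le_one₀ hr.1 hr.2
    simpa [← Complex.ofReal_pow] using this
  unfold chartImSq
  exact (continuous_imSq φ).continuousAt.comp (continuousAt_const.mul (continuousAt_id.mul (h.pow 2)))

theorem continuousAt_chartImSq_left (φ : ℝ) {a : ℂ} (ha : 0 < a.im) :
    ContinuousAt (chartImSq φ a (-4)) a :=
  continuousAt_chartImSq φ (ne_zero_of_im_pos ha) <| Complex.mem_slitPlane_iff.2 <| .inr <| by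
    have : 1 - a / (-4) = 1 + ((1 / 4 : ℝ) : ℂ) * a := by push_cast; ring
    rw [this, Complex.add_im, Complex.one_im, Complex.im_ofReal_mul]
    positivity

theorem continuousAt_chartImSq_right (φ : ℝ) {a : ℂ} (ha : 0 < a.im) :
    ContinuousAt (chartImSq φ (4 + a) 4) (4 + a) :=
  continuousAt_chartImSq φ (four_add_ne_zero_of_im_pos ha) <| Complex.mem_slitPlane_iff.2 <|
    .inr <| by
    have : 1 - (4 + a) / 4 = ((-1 / 4 : ℝ) : ℂ) * a := by push_cast; ring
    rw [this, Complex.im_ofReal_mul]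
    exact mul_ne_zero (by norm_num) ha.ne'

theorem im_chartPrimitive_left_sq (φ : ℝ) {a : ℂ} (ha : 0 < a.im) {z s v : ℂ}
    (e1 : s ^ 2 = z ^ 2 + 4) (e2 : v ^ 2 = z ^ 2 - a) (hx : z ^ 2 ∈ chartDomain a (-4)) :
    (Complex.exp (φ * Complex.I) * chartPrimitive a (-4) z s v).im ^ 2 =
      chartImSq φ a (-4) (z ^ 2) :=
  im_chartPrimitive_sq φ (ne_zero_of_im_pos ha) (by norm_num) (by linear_combination e1) e2 hx

theorem im_chartPrimitive_right_sq (φ : ℝ) {a : ℂ} (ha : 0 < a.im) {z s v : ℂ}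
    (e1 : s ^ 2 = z ^ 2 + 4) (e2 : v ^ 2 = z ^ 2 - a) (hx : z ^ 2 + 4 ∈ chartDomain (4 + a) 4) :
    (Complex.exp (φ * Complex.I) * chartPrimitive (4 + a) 4 s z v).im ^ 2 =
      chartImSq φ (4 + a) 4 (z ^ 2 + 4) := by
  rw [im_chartPrimitive_sq φ (four_add_ne_zero_of_im_pos ha) (by norm_num)
    (by linear_combination -e1) (by linear_combination e2 - e1) (by rwa [e1]), e1]

/-- The two period conditions. -/
structure PeriodConditions (φ : ℝ) (a : ℂ) : Prop where
  im_pos : 0 < a.im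
  tip : chartImSq φ a (-4) a = 0
  base : (Complex.exp (φ * Complex.I) *
    ∫ τ in (0 : ℝ)..(Real.pi / 2), (4 * (Real.sin τ : ℂ) ^ 2 + a).sqrt).im = 0

/-! ### Agreement of the imaginary parts on both components of the overlap -/

namespace PeriodConditions

variable {φ : ℝ} {a : ℂ}

theorem im_chartDifference_of_not_wedge (h : PeriodConditions φ a) {α β : ℝ}
    (hx : (α * a + β : ℂ) ∈ overlap a) (hw : ¬ (1 < α ∧ 0 < β ∧ β < 4 * (α - 1))) :
    (Complex.exp (φ * Complex.I) * chartDifference a (overlapZ (α * a + β))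
      (overlapS (α * a + β)) (overlapV a (α * a + β))).im = 0 := by
  have := chartDifference_segment_eq h.im_pos (-2) ((α * a + β) - (-2)) zero_le_one
    fun r hr => segment_mem_overlap_of_not_wedge h.im_pos hx hw hr
  simp only [Complex.ofReal_one, one_mul, Complex.ofReal_zero, zero_mul, add_zero] at this
  rw [show (-2 + ((α * a + β) - (-2)) : ℂ) = α * a + β by ring] at this
  rw [this]
  exact chartDifference_base h.im_pos h.base

/-- The open segment from `0` to `a` lies in the component of `-2`, where the imaginary parts
already agree. Let the point tend to `a`; both squared imaginary parts are continuous there. -/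
theorem tip_right (h : PeriodConditions φ a) : chartImSq φ (4 + a) 4 (4 + a) = 0 := by
  have ha := h.im_pos
  have ha0 := ne_zero_of_im_pos ha
  have hp : Tendsto (fun r : ℝ => (r : ℂ) * a) (𝓝[<] 1) (𝓝 a) := by
    have : ContinuousAt (fun r : ℝ => (r : ℂ) * a) 1 := by fun_prop
    simpa [ContinuousAt] using this.mono_left (nhdsWithin_le_nhds (s := Set.Iio 1))
  have h1 : Tendsto (fun r : ℝ => chartImSq φ a (-4) (r * a)) (𝓝[<] 1) (𝓝 0) := by
    rw [← h.tip]
    exact (continuousAt_chartImSq_left φ ha).tendsto.comp hp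
  have h2 : Tendsto (fun r : ℝ => chartImSq φ (4 + a) 4 (r * a + 4)) (𝓝[<] 1)
      (𝓝 (chartImSq φ (4 + a) 4 (4 + a))) := by
    refine (continuousAt_chartImSq_right φ ha).tendsto.comp ?_
    simpa [add_comm] using hp.add_const 4
  refine tendsto_nhds_unique h2 (h1.congr' ?_)
  filter_upwards [Ioo_mem_nhdsLT (zero_lt_one' ℝ)] with r hr
  have hmem : (r * a + (0 : ℝ) : ℂ) ∈ overlap a := by
    rw [mem_overlap_iff ha]
    rintro (⟨-, h⟩ | ⟨h, -⟩ | ⟨h, -⟩ | ⟨h, -⟩) <;> linarith [hr.1, hr.2]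
  have hD := h.im_chartDifference_of_not_wedge hmem (by simp)
  simp only [Complex.ofReal_zero, add_zero] at hD hmem
  have e1 : overlapS (r * a) ^ 2 = overlapZ (r * a) ^ 2 + 4 := by rw [overlapZ_sq, overlapS_sq]
  have e2 : overlapV a (r * a) ^ 2 = overlapZ (r * a) ^ 2 - a := by
    rw [overlapZ_sq, overlapV_sq ha0]
  have q1 := im_chartPrimitive_left_sq φ ha e1 e2 (by rw [overlapZ_sq]; exact hmem.1)
  have q2 := im_chartPrimitive_right_sq φ ha e1 e2 (by rw [overlapZ_sq]; exact hmem.2)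
  rw [chartDifference, mul_sub, Complex.sub_im, sub_eq_zero] at hD
  rw [overlapZ_sq] at q1 q2
  rw [← q1, ← q2, hD]

/-- The difference is constant on rays from `a`, and both imaginary parts tend to `0` at the vertex
by the two tip conditions. -/
theorem im_chartDifference_of_wedge (h : PeriodConditions φ a) {α β : ℝ}
    (hw : 1 < α ∧ 0 < β ∧ β < 4 * (α - 1)) :
    (Complex.exp (φ * Complex.I) * chartDifference a (overlapZ (α * a + β))
      (overlapS (α * a + β)) (overlapV a (α * a + β))).im = 0 := by
  have ha := h.im_pos
  have ha0 := ne_zero_of_im_pos ha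
  set d : ℂ := (α * a + β) - a with hd
  have hp : Tendsto (fun r : ℝ => a + r * d) (𝓝[>] 0) (𝓝 a) := by
    have : ContinuousAt (fun r : ℝ => a + r * d) 0 := by fun_prop
    simpa [ContinuousAt] using this.mono_left (nhdsWithin_le_nhds (s := Set.Ioi 0))
  have h1 : Tendsto (fun r : ℝ => chartImSq φ a (-4) (a + r * d)) (𝓝[>] 0) (𝓝 0) := by
    have := (continuousAt_chartImSq_left φ ha).tendsto.comp hp
    rwa [h.tip] at this
  have h2 : Tendsto (fun r : ℝ => chartImSq φ (4 + a) 4 (a + r * d + 4)) (𝓝[>] 0) (𝓝 0) := by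
    have := (continuousAt_chartImSq_right φ ha).tendsto.comp
      (show Tendsto (fun r : ℝ => a + r * d + 4) (𝓝[>] 0) (𝓝 (4 + a)) by
        simpa [add_comm] using hp.add_const 4)
    rwa [h.tip_right] at this
  have h3 := (h1.add h2).const_mul 2
  rw [add_zero, mul_zero] at h3
  -- With `p`, `q` the two imaginary parts, `(p - q)² ≤ 2 (p² + q²)`, and the right side tends to
  -- `0` as `r → 0⁺`.
  refine pow_eq_zero_iff two_ne_zero |>.1 (le_antisymm (ge_of_tendsto h3 ?_) (sq_nonneg _))
  filter_upwards [Ioo_mem_nhdsGT (zero_lt_one' ℝ)] with r hr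
  have hseg := chartDifference_segment_eq ha a d hr.2.le fun ρ hρ =>
    segment_mem_overlap_of_wedge ha hw (hr.1.trans_le hρ.1)
  have hmem := segment_mem_overlap_of_wedge ha hw hr.1
  rw [← hd] at hmem
  rw [Complex.ofReal_one, one_mul, show a + d = α * a + β by rw [hd]; ring] at hseg
  rw [hseg]
  set x := a + r * d
  have e1 : overlapS x ^ 2 = overlapZ x ^ 2 + 4 := by rw [overlapZ_sq, overlapS_sq]
  have e2 : overlapV a x ^ 2 = overlapZ x ^ 2 - a := by
    rw [overlapZ_sq, overlapV_sq ha0]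
  have q1 := im_chartPrimitive_left_sq φ ha e1 e2 (by rw [overlapZ_sq]; exact hmem.1)
  have q2 := im_chartPrimitive_right_sq φ ha e1 e2 (by rw [overlapZ_sq]; exact hmem.2)
  rw [overlapZ_sq] at q1 q2
  rw [← q1, ← q2, chartDifference, mul_sub, Complex.sub_im]
  nlinarith [sq_nonneg ((Complex.exp (φ * Complex.I) *
    chartPrimitive a (-4) (overlapZ x) (overlapS x) (overlapV a x)).im +
    (Complex.exp (φ * Complex.I) *
      chartPrimitive (4 + a) 4 (overlapS x) (overlapZ x) (overlapV a x)).im)]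

/-- The imaginary parts of the two primitives agree over the overlap. -/
theorem im_chartPrimitive_eq (h : PeriodConditions φ a) {z s v : ℂ}
    (e1 : s ^ 2 = z ^ 2 + 4) (e2 : v ^ 2 = z ^ 2 - a) (hx : z ^ 2 ∈ overlap a) :
    (Complex.exp (φ * Complex.I) * chartPrimitive a (-4) z s v).im =
      (Complex.exp (φ * Complex.I) * chartPrimitive (4 + a) 4 s z v).im := by
  obtain ⟨α, β, hc⟩ := exists_real_coordinates h.im_pos (z ^ 2)
  have hD : (Complex.exp (φ * Complex.I) * chartDifference a (overlapZ (z ^ 2))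
      (overlapS (z ^ 2)) (overlapV a (z ^ 2))).im = 0 := by
    rw [hc] at hx ⊢
    by_cases hw : 1 < α ∧ 0 < β ∧ β < 4 * (α - 1)
    · exact h.im_chartDifference_of_wedge hw
    · exact h.im_chartDifference_of_not_wedge hx hw
  have := im_mul_chartDifference_eq_zero (a := a) (z' := z) (s' := s) (v' := v)
    (by rw [overlapZ_sq]) (by rw [overlapS_sq, e1])
    (by rw [overlapV_sq (ne_zero_of_im_pos h.im_pos), e2]) hD
  rwa [chartDifference, mul_sub, Complex.sub_im, sub_eq_zero] at this

end PeriodConditions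

open Classical in
/-- The globally defined imaginary part of `exp (i φ)` times the primitive. -/
noncomputable def imPrimitive (φ : ℝ) (a z s v : ℂ) : ℝ :=
  if z ^ 2 ∈ chartDomain a (-4) then (Complex.exp (φ * Complex.I) * chartPrimitive a (-4) z s v).im
  else (Complex.exp (φ * Complex.I) * chartPrimitive (4 + a) 4 s z v).im

/-! ### A primitive that vanishes on the zero set of the derivative -/

/-- Apply the mean value theorem between `t` and the last point of `Z` in `[s, t]`. -/
theorem abs_le_of_hasDerivAt_off_zeros {U g : ℝ → ℝ} {Z : Set ℝ} (hZ : IsClosed Z)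
    (hU : Continuous U) (hU0 : ∀ t ∈ Z, U t = 0) (hd : ∀ t ∉ Z, HasDerivAt U (g t) t)
    {s t ε : ℝ} (hst : s ≤ t) (hs : s ∈ Z) (hg : ∀ τ ∈ Set.Icc s t, |g τ| ≤ ε) :
    |U t| ≤ ε * (t - s) := by
  have hε : 0 ≤ ε := (abs_nonneg _).trans (hg s ⟨le_rfl, hst⟩)
  obtain ⟨m, ⟨hmZ, hm⟩, hmax⟩ := (isCompact_Icc.inter_left hZ : IsCompact (Z ∩ Set.Icc s t))
    |>.exists_isGreatest ⟨s, hs, le_rfl, hst⟩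
  rcases hm.2.eq_or_lt with rfl | hmt
  · rw [hU0 _ hmZ, abs_zero]
    exact mul_nonneg hε (by linarith)
  have hout : ∀ τ ∈ Set.Ioo m t, τ ∉ Z := fun τ hτ hτZ =>
    absurd (hmax ⟨hτZ, hm.1.trans hτ.1.le, hτ.2.le⟩) (not_le.2 hτ.1)
  obtain ⟨c, hc, hc'⟩ := exists_hasDerivAt_eq_slope U g hmt hU.continuousOn
    fun τ hτ => hd τ (hout τ hτ)
  rw [hU0 m hmZ, sub_zero, eq_div_iff (by linarith)] at hc'
  rw [← hc', abs_mul, abs_of_pos (by linarith : 0 < t - m)]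
  exact mul_le_mul (hg c ⟨hm.1.trans hc.1.le, hc.2.le⟩) (by linarith [hm.1]) (by linarith) hε

/-- A cycle may lie over `x = a` on an arbitrary closed set of times, where neither chart applies.
There `U` and `g` both vanish, and the smallness of `g` nearby gives derivative zero. -/
theorem hasDerivAt_of_hasDerivAt_off_zeros {U g : ℝ → ℝ} {Z : Set ℝ} (hZ : IsClosed Z)
    (hU : Continuous U) (hg : Continuous g) (hU0 : ∀ t ∈ Z, U t = 0) (hg0 : ∀ t ∈ Z, g t = 0)
    (hd : ∀ t ∉ Z, HasDerivAt U (g t) t) (t : ℝ) : HasDerivAt U (g t) t := by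
  by_cases ht : t ∈ Z
  swap
  · exact hd t ht
  rw [hg0 t ht, hasDerivAt_iff_isLittleO]
  refine Asymptotics.isLittleO_iff.2 fun ε hε => ?_
  obtain ⟨δ, hδ, hb⟩ := Metric.continuousAt_iff.1 hg.continuousAt ε hε
  filter_upwards [Metric.ball_mem_nhds t hδ] with τ hτ
  rw [hU0 t ht, sub_zero, smul_zero, sub_zero, Real.norm_eq_abs, Real.norm_eq_abs]
  have hτ' : |τ - t| < δ := by simpa [Real.dist_eq] using hτ
  have hb' : ∀ σ, |σ - t| < δ → |g σ| ≤ ε := fun σ hσ => by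
    have := hb (x := σ) (by simpa [Real.dist_eq] using hσ)
    rw [hg0 t ht, Real.dist_eq, sub_zero] at this
    exact this.le
  rcases le_total t τ with h | h
  · rw [abs_of_nonneg (by linarith : 0 ≤ τ - t)] at hτ' ⊢
    refine abs_le_of_hasDerivAt_off_zeros hZ hU hU0 hd h ht fun σ hσ => hb' σ ?_
    rw [abs_of_nonneg (by linarith [hσ.1])]; linarith [hσ.2]
  · rw [abs_of_nonpos (by linarith : τ - t ≤ 0)] at hτ' ⊢
    have := abs_le_of_hasDerivAt_off_zeros (U := fun x => U (-x)) (g := fun x => -g (-x))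
      (Z := {x | -x ∈ Z}) (hZ.preimage continuous_neg) (hU.comp continuous_neg)
      (fun x hx => hU0 _ hx) (fun x hx => by
        simpa [Function.comp_def] using! (hd (-x) hx).comp x (hasDerivAt_neg x)) (neg_le_neg h)
      (show -(-t) ∈ Z by rwa [neg_neg]) (ε := ε) (fun σ hσ => by
        rw [abs_neg]
        refine hb' _ ?_
        rw [abs_lt]
        constructor <;> linarith [hσ.1, hσ.2])
    rw [neg_neg] at this
    convert this using 2
    ring

/-! ### The period conditions imply the Boutroux equations -/

theorem PeriodConditions.hasDerivAt_imPrimitive {φ : ℝ} {a : ℂ} (h : PeriodConditions φ a)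
    {z s v η : ℝ → ℂ} (hz : ∀ t, HasDerivAt z (s t * η t) t)
    (hs : ∀ t, HasDerivAt s (z t * η t) t) (hv : Continuous v) (hη : Continuous η)
    (e1 : ∀ t, s t ^ 2 = z t ^ 2 + 4) (e2 : ∀ t, v t ^ 2 = z t ^ 2 - a) (t : ℝ) :
    HasDerivAt (fun t => imPrimitive φ a (z t) (s t) (v t))
      (Complex.exp (φ * Complex.I) * (v t * η t)).im t := by
  have ha := h.im_pos
  have ha0 := ne_zero_of_im_pos ha
  have hzc : Continuous z := continuous_iff_continuousAt.2 fun t => (hz t).continuousAt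
  have h0 : ∀ t, v t = 0 ↔ z t ^ 2 = a := fun t => by
    rw [← sub_eq_zero (a := z t ^ 2), ← e2, sq_eq_zero_iff]
  have hU0 : ∀ t, v t = 0 → imPrimitive φ a (z t) (s t) (v t) = 0 := fun t ht => by
    simp [imPrimitive, chartPrimitive, ht]
  have hIm : ∀ {f : ℝ → ℂ} {f' : ℂ} {t : ℝ}, HasDerivAt f f' t →
      HasDerivAt (fun t => (Complex.exp (φ * Complex.I) * f t).im)
        (Complex.exp (φ * Complex.I) * f').im t := fun hf =>
    Complex.imCLM.hasFDerivAt.comp_hasDerivAt _ (hf.const_mul _)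
  have hd : ∀ t, v t ≠ 0 → HasDerivAt (fun t => imPrimitive φ a (z t) (s t) (v t))
      (Complex.exp (φ * Complex.I) * (v t * η t)).im t := by
    intro t ht
    rcases mem_chartDomain_or ha (fun hx => ht ((h0 t).2 hx)) with hx | hx
    · refine (hIm (hasDerivAt_chartPrimitive_left ha (hz t) (hs t) hv.continuousAt
        (Eventually.of_forall e1) (Eventually.of_forall e2) hx)).congr_of_eventuallyEq ?_
      filter_upwards [(hzc.pow 2).continuousAt.eventually_mem
        ((isOpen_chartDomain _ _).mem_nhds hx)] with τ hτ
      exact if_pos hτ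
    · refine (hIm (hasDerivAt_chartPrimitive_right ha (hz t) (hs t) hv.continuousAt
        (Eventually.of_forall e1) (Eventually.of_forall e2) hx)).congr_of_eventuallyEq ?_
      filter_upwards [((hzc.pow 2).add_const 4).continuousAt.eventually_mem
        ((isOpen_chartDomain _ _).mem_nhds hx)] with τ hτ
      by_cases h' : z τ ^ 2 ∈ chartDomain a (-4)
      · rw [imPrimitive, if_pos h', h.im_chartPrimitive_eq (e1 τ) (e2 τ) ⟨h', hτ⟩]
      · exact if_neg h'
  -- At a zero of `v`, the square of `imPrimitive` is bounded by the sum of the absolute values of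
  -- the two chart expressions, and both tend to `0`.
  have hUc : Continuous fun t => imPrimitive φ a (z t) (s t) (v t) := by
    refine continuous_iff_continuousAt.2 fun t => ?_
    by_cases ht : v t = 0
    swap
    · exact (hd t ht).continuousAt
    rw [ContinuousAt, hU0 t ht]
    have hza : z t ^ 2 = a := (h0 t).1 ht
    have l1 : Tendsto (fun t => chartImSq φ a (-4) (z t ^ 2)) (𝓝 t) (𝓝 0) := by
      rw [← h.tip]
      refine (continuousAt_chartImSq_left φ ha).tendsto.comp ?_
      simpa [hza] using (hzc.fun_pow 2).tendsto t
    have l2 : Tendsto (fun t => chartImSq φ (4 + a) 4 (z t ^ 2 + 4)) (𝓝 t) (𝓝 0) := by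
      rw [← h.tip_right]
      refine (continuousAt_chartImSq_right φ ha).tendsto.comp ?_
      simpa [hza, add_comm] using ((hzc.fun_pow 2).add_const 4).tendsto t
    have l3 : Tendsto (fun t => imPrimitive φ a (z t) (s t) (v t) ^ 2) (𝓝 t) (𝓝 0) := by
      refine squeeze_zero (fun _ => sq_nonneg _) (fun τ => ?_) (by simpa using l1.abs.add l2.abs)
      by_cases hτ : v τ = 0
      · rw [hU0 τ hτ, zero_pow two_ne_zero]
        exact add_nonneg (abs_nonneg _) (abs_nonneg _)
      by_cases hx : z τ ^ 2 ∈ chartDomain a (-4)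
      · rw [imPrimitive, if_pos hx, im_chartPrimitive_left_sq φ ha (e1 τ) (e2 τ) hx]
        exact (le_abs_self _).trans (le_add_of_nonneg_right (abs_nonneg _))
      · have hx' := (mem_chartDomain_or ha (fun hx => hτ ((h0 τ).2 hx))).resolve_left hx
        rw [imPrimitive, if_neg hx, im_chartPrimitive_right_sq φ ha (e1 τ) (e2 τ) hx']
        exact (le_abs_self _).trans (le_add_of_nonneg_left (abs_nonneg _))
    have l4 := l3.sqrt
    simp only [Real.sqrt_sq_eq_abs, Real.sqrt_zero] at l4
    exact (tendsto_zero_iff_abs_tendsto_zero _).2 l4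
  refine hasDerivAt_of_hasDerivAt_off_zeros (Z := {t | v t = 0})
    (g := fun t => (Complex.exp (φ * Complex.I) * (v t * η t)).im)
    (isClosed_eq hv continuous_const) hUc (by fun_prop) hU0 ?_ hd t
  intro t ht
  simp [show v t = 0 from ht]

theorem PeriodConditions.solvesBoutroux {φ : ℝ} {a : ℂ} (h : PeriodConditions φ a) :
    SolvesBoutroux φ (a + 2) := by
  intro c
  have hl := c.lam_ne_zero
  have hld : ∀ t, HasDerivAt c.lam (deriv c.lam t) t := fun t =>
    (c.contDiff_lam.differentiable one_ne_zero t).hasDerivAt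
  have hlc := c.contDiff_lam.continuous
  have hlc' : Continuous (deriv c.lam) := c.contDiff_lam.continuous_deriv le_rfl
  have hinv : ∀ t, HasDerivAt (fun t => (c.lam t)⁻¹) (-deriv c.lam t / c.lam t ^ 2) t := fun t =>
    (hld t).fun_inv (hl t)
  have hη : Continuous fun t => deriv c.lam t / c.lam t := hlc'.div hlc hl
  have hv : Continuous fun t => c.w t / c.lam t := c.continuous_w.div hlc hl
  have key := h.hasDerivAt_imPrimitive (z := fun t => c.lam t - (c.lam t)⁻¹)
    (s := fun t => c.lam t + (c.lam t)⁻¹) (v := fun t => c.w t / c.lam t)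
    (η := fun t => deriv c.lam t / c.lam t)
    (fun t => ((hld t).fun_sub (hinv t)).congr_deriv (by have := hl t; field_simp; ring))
    (fun t => ((hld t).fun_add (hinv t)).congr_deriv (by have := hl t; field_simp; ring))
    hv hη (fun t => by have := hl t; field_simp; ring)
    (fun t => by
      have := hl t
      rw [div_pow, c.on_curve]; field_simp; ring)
  have hcont : Continuous fun t => c.w t / c.lam t * (deriv c.lam t / c.lam t) := hv.mul hη
  have hI : c.integral = ∫ t in (0 : ℝ)..1, c.w t / c.lam t * (deriv c.lam t / c.lam t) := by
    refine intervalIntegral.integral_congr fun t _ => ?_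
    have := hl t
    field_simp
  have hFTC := intervalIntegral.integral_eq_sub_of_hasDerivAt (a := 0) (b := 1)
    (fun t _ => key t) (Continuous.intervalIntegrable (by fun_prop) _ _)
  have hper : c.lam 1 = c.lam 0 := by simpa using c.periodic_lam 0
  have hper' : c.w 1 = c.w 0 := by simpa using c.periodic_w 0
  simp only [hper, hper', sub_self] at hFTC
  rw [hI, ← intervalIntegral.integral_const_mul]
  have hint : IntervalIntegrable (fun t => Complex.exp (φ * Complex.I) *
      (c.w t / c.lam t * (deriv c.lam t / c.lam t))) MeasureTheory.volume 0 1 :=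
    (continuous_const.mul hcont).intervalIntegrable _ _
  exact (Complex.imCLM.intervalIntegral_comp_comm hint).symm.trans hFTC

/-! ### Two explicit cycles -/

/-- The cycle over the unit circle, for a given continuous branch of the square root. -/
noncomputable def circleCycle (a : ℂ) (V : ℝ → ℂ) (hV : Continuous V) (hper : Function.Periodic V 1)
    (hsq : ∀ t, V t ^ 2 = 4 * (Real.sin (2 * Real.pi * t) : ℂ) ^ 2 + a) : CurveCycle (a + 2) where
  lam t := Complex.exp ((2 * Real.pi * t : ℝ) * Complex.I)
  w t := Complex.exp ((2 * Real.pi * t : ℝ) * Complex.I) * (Complex.I * V t)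
  contDiff_lam := by
    have : ContDiff ℝ 1 fun t : ℝ => ((2 * Real.pi * t : ℝ) : ℂ) :=
      Complex.ofRealCLM.contDiff.comp (contDiff_const.mul contDiff_id)
    exact (this.mul contDiff_const).cexp
  continuous_w := by fun_prop
  periodic_lam t := by
    have : ((2 * Real.pi * (t + 1) : ℝ) : ℂ) * Complex.I =
        ((2 * Real.pi * t : ℝ) : ℂ) * Complex.I + 2 * Real.pi * Complex.I := by push_cast; ring
    simp only [this, Complex.exp_periodic _]
  periodic_w t := by
    have : ((2 * Real.pi * (t + 1) : ℝ) : ℂ) * Complex.I =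
        ((2 * Real.pi * t : ℝ) : ℂ) * Complex.I + 2 * Real.pi * Complex.I := by push_cast; ring
    simp only [this, Complex.exp_periodic _, hper t]
  lam_ne_zero t := Complex.exp_ne_zero _
  on_curve t := by
    rw [mul_pow, mul_pow, hsq, Complex.I_sq, Complex.exp_mul_I, ← Complex.ofReal_cos,
      ← Complex.ofReal_sin]
    have h : (Real.cos (2 * Real.pi * t) : ℂ) ^ 2 = 1 - (Real.sin (2 * Real.pi * t) : ℂ) ^ 2 := by
      rw [← Complex.ofReal_pow, Real.cos_sq']; push_cast; rfl
    generalize (Real.cos (2 * Real.pi * t) : ℂ) = x at *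
    generalize (Real.sin (2 * Real.pi * t) : ℂ) = y at *
    have hI := Complex.I_sq
    generalize Complex.I = i at *
    have h1 : (x + y * i) * (x - y * i) = 1 := by linear_combination h - y ^ 2 * hI
    have h2 : (x + y * i) ^ 4 + 1 = (x + y * i) ^ 2 * ((x + y * i) ^ 2 + (x - y * i) ^ 2) := by
      linear_combination (-1 - (x + y * i) * (x - y * i)) * h1
    linear_combination -h2 - (x + y * i) ^ 2 * (2 * h + 2 * y ^ 2 * hI)

/-- On `λ = e^{2πit}` one has `v = i V` and `η = 2πi dt`, so the differential is `-2π V dt`. -/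
theorem SolvesBoutroux.im_circle {φ : ℝ} {a : ℂ} (h : SolvesBoutroux φ (a + 2)) {V : ℝ → ℂ}
    (hV : Continuous V) (hper : Function.Periodic V 1)
    (hsq : ∀ t, V t ^ 2 = 4 * (Real.sin (2 * Real.pi * t) : ℂ) ^ 2 + a) :
    (Complex.exp (φ * Complex.I) * ∫ t in (0 : ℝ)..1, V t).im = 0 := by
  have h1 := h (circleCycle a V hV hper hsq)
  have hd : ∀ t : ℝ, HasDerivAt (fun t : ℝ => Complex.exp ((2 * Real.pi * t : ℝ) * Complex.I))
      (Complex.exp ((2 * Real.pi * t : ℝ) * Complex.I) * (2 * Real.pi * Complex.I)) t := fun t => by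
    have := (((hasDerivAt_id' t).const_mul (2 * Real.pi)).ofReal_comp.mul_const Complex.I).cexp
    simpa using this
  have h2 : (circleCycle a V hV hper hsq).integral =
      ((-(2 * Real.pi) : ℝ) : ℂ) * ∫ t in (0 : ℝ)..1, V t := by
    rw [← intervalIntegral.integral_const_mul]
    refine intervalIntegral.integral_congr fun t _ => ?_
    simp only [circleCycle, (hd t).deriv]
    have := Complex.exp_ne_zero (((2 * Real.pi * t : ℝ) : ℂ) * Complex.I)
    generalize Complex.exp (((2 * Real.pi * t : ℝ) : ℂ) * Complex.I) = E at *
    field_simp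
    push_cast
    linear_combination (2 * V t * Real.pi) * Complex.I_sq
  rw [h2, mul_left_comm, Complex.im_ofReal_mul] at h1
  exact (mul_eq_zero.1 h1).resolve_left (by simp [Real.pi_ne_zero])

/-- Data along the cycle around a pair of branch points. -/
noncomputable def pairS (a : ℂ) (t : ℝ) : ℂ :=
  (4 + (Real.cos (2 * Real.pi * t) : ℂ) ^ 2 * a).sqrt

/-- Solution of `λ - 1/λ = b cos(2πt)`: here `z` runs back and forth between the zeros `±b` of `z² -
b²`, and `v = i b sin(2πt)` is a root that closes up. -/
noncomputable def pairLam (b : ℂ) (t : ℝ) : ℂ :=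
  (b * Real.cos (2 * Real.pi * t) + pairS (b ^ 2) t) / 2

theorem four_add_sq_mul_mem_slitPlane {a : ℂ} (ha : 4 + a ∈ Complex.slitPlane) {c : ℝ}
    (hc : c ∈ Set.Icc (-1 : ℝ) 1) : 4 + (c : ℂ) ^ 2 * a ∈ Complex.slitPlane := by
  have := (Complex.starConvex_ofReal_slitPlane (x := 4) (by norm_num)).add_smul_sub_mem
    (y := 4 + a) ha (t := c ^ 2) (by positivity) (by nlinarith [hc.1, hc.2])
  simpa [Complex.real_smul] using this

theorem pairS_mem {a : ℂ} (ha : 4 + a ∈ Complex.slitPlane) (t : ℝ) :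
    4 + (Real.cos (2 * Real.pi * t) : ℂ) ^ 2 * a ∈ Complex.slitPlane :=
  four_add_sq_mul_mem_slitPlane ha ⟨Real.neg_one_le_cos _, Real.cos_le_one _⟩

theorem pairS_ne_zero {a : ℂ} (ha : 4 + a ∈ Complex.slitPlane) (t : ℝ) : pairS a t ≠ 0 :=
  Complex.sqrt_ne_zero_of_ne_zero (Complex.slitPlane_ne_zero (pairS_mem ha t))

theorem continuous_pairS {a : ℂ} (ha : 4 + a ∈ Complex.slitPlane) : Continuous (pairS a) := by
  refine continuous_iff_continuousAt.2 fun t => ?_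
  exact ContinuousAt.comp (f := fun t : ℝ => 4 + (Real.cos (2 * Real.pi * t) : ℂ) ^ 2 * a)
    (Complex.differentiableAt_sqrt (pairS_mem ha t)).continuousAt (by fun_prop)

theorem pairLam_sq (b : ℂ) (t : ℝ) :
    pairLam b t ^ 2 = b * Real.cos (2 * Real.pi * t) * pairLam b t + 1 := by
  have h : pairS (b ^ 2) t ^ 2 = 4 + (Real.cos (2 * Real.pi * t) : ℂ) ^ 2 * b ^ 2 :=
    Complex.sqrt_sq_self _
  rw [pairLam]
  linear_combination (1 / 4) * h

theorem pairLam_ne_zero (b : ℂ) (t : ℝ) : pairLam b t ≠ 0 := fun h => by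
  simpa [h] using pairLam_sq b t

theorem hasDerivAt_pairLam {b : ℂ} (ha : 4 + b ^ 2 ∈ Complex.slitPlane) (t : ℝ) :
    HasDerivAt (pairLam b) (-(2 * Real.pi * b * Real.sin (2 * Real.pi * t)) * pairLam b t /
      pairS (b ^ 2) t) t := by
  have hz : HasDerivAt (fun t : ℝ => (Real.cos (2 * Real.pi * t) : ℂ))
      (-(2 * Real.pi * Real.sin (2 * Real.pi * t))) t := by
    have := ((Real.hasDerivAt_cos _).comp t ((hasDerivAt_id' t).const_mul (2 * Real.pi))).ofReal_comp
    refine this.congr_deriv ?_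
    push_cast; ring
  have hs := HasDerivAt.comp_real_complex
    (g := fun t : ℝ => 4 + (Real.cos (2 * Real.pi * t) : ℂ) ^ 2 * b ^ 2)
    (Complex.hasDerivAt_sqrt' (pairS_mem ha t)) (((hz.fun_pow 2).mul_const (b ^ 2)).const_add 4)
  refine (((hz.const_mul b).fun_add hs).div_const 2).congr_deriv ?_
  have h0 := pairS_ne_zero ha t
  change (_ + 1 / (2 * pairS (b ^ 2) t) * _) / 2 = _
  rw [pairLam]
  field_simp
  push_cast
  ring

/-- The cycle around a pair of branch points. -/
noncomputable def pairCycle (b : ℂ) (ha : 4 + b ^ 2 ∈ Complex.slitPlane) :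
    CurveCycle (b ^ 2 + 2) where
  lam := pairLam b
  w t := pairLam b t * (Complex.I * b * Real.sin (2 * Real.pi * t))
  contDiff_lam := by
    have hd : Differentiable ℝ (pairLam b) := fun t => (hasDerivAt_pairLam ha t).differentiableAt
    refine contDiff_one_iff_deriv.2 ⟨hd, ?_⟩
    rw [funext fun t => (hasDerivAt_pairLam ha t).deriv]
    exact ((by fun_prop : Continuous fun t : ℝ =>
      -(2 * Real.pi * b * (Real.sin (2 * Real.pi * t) : ℂ))).mul hd.continuous).div
      (continuous_pairS ha) (pairS_ne_zero ha)
  continuous_w := by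
    have hd : Differentiable ℝ (pairLam b) := fun t => (hasDerivAt_pairLam ha t).differentiableAt
    exact hd.continuous.mul (by fun_prop)
  periodic_lam t := by
    simp only [pairLam, pairS, mul_add, mul_one, Real.cos_add_two_pi]
  periodic_w t := by
    simp only [pairLam, pairS, mul_add, mul_one, Real.cos_add_two_pi, Real.sin_add_two_pi]
  lam_ne_zero := pairLam_ne_zero b
  on_curve t := by
    have h1 := pairLam_sq b t
    have h : (Real.cos (2 * Real.pi * t) : ℂ) ^ 2 = 1 - (Real.sin (2 * Real.pi * t) : ℂ) ^ 2 := by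
      rw [← Complex.ofReal_pow, Real.cos_sq']; push_cast; rfl
    generalize (Real.cos (2 * Real.pi * t) : ℂ) = x at *
    generalize (Real.sin (2 * Real.pi * t) : ℂ) = y at *
    generalize pairLam b t = l at *
    linear_combination (l ^ 2 * b ^ 2 * y ^ 2) * Complex.I_sq - (l ^ 2 - 1 + b * x * l) * h1
      - l ^ 2 * b ^ 2 * h

/-- On the pair cycle the differential is `-2πi b² sin² / s dt`. The factor `i` turns the imaginary
part into a real part, and only `b² = a` enters. -/
theorem SolvesBoutroux.re_pair {φ : ℝ} {a : ℂ} (h : SolvesBoutroux φ (a + 2))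
    (ha : 4 + a ∈ Complex.slitPlane) :
    (Complex.exp (φ * Complex.I) * (a * ∫ t in (0 : ℝ)..1,
      (Real.sin (2 * Real.pi * t) : ℂ) ^ 2 / pairS a t)).re = 0 := by
  obtain ⟨b, rfl⟩ : ∃ b : ℂ, a = b ^ 2 := ⟨a.sqrt, a.sqrt_sq_self.symm⟩
  have h1 := h (pairCycle b ha)
  have h2 : (pairCycle b ha).integral = ((-(2 * Real.pi) : ℝ) : ℂ) * (Complex.I *
      (b ^ 2 * ∫ t in (0 : ℝ)..1, (Real.sin (2 * Real.pi * t) : ℂ) ^ 2 / pairS (b ^ 2) t)) := by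
    rw [← intervalIntegral.integral_const_mul, ← intervalIntegral.integral_const_mul,
      ← intervalIntegral.integral_const_mul]
    refine intervalIntegral.integral_congr fun t _ => ?_
    simp only [pairCycle, (hasDerivAt_pairLam ha t).deriv]
    have h0 := pairS_ne_zero ha t
    have h3 := pairLam_ne_zero b t
    generalize pairLam b t = l at *
    generalize pairS (b ^ 2) t = s at *
    field_simp
    push_cast
    ring
  rw [h2, mul_left_comm, Complex.im_ofReal_mul] at h1
  have h3 := (mul_eq_zero.1 h1).resolve_left (by simp [Real.pi_ne_zero])
  rwa [mul_left_comm, Complex.I_mul_im] at h3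

/-! ### Complex conjugation -/

theorem SolvesBoutroux.conj {φ : ℝ} {A : ℂ} (h : SolvesBoutroux φ A) :
    SolvesBoutroux (-φ) (starRingEnd ℂ A) := by
  intro c
  have hl : ContDiff ℝ 1 fun t => starRingEnd ℂ (c.lam t) :=
    Complex.conjCLE.contDiff.comp c.contDiff_lam
  let c' : CurveCycle A :=
    { lam := fun t => starRingEnd ℂ (c.lam t)
      w := fun t => starRingEnd ℂ (c.w t)
      contDiff_lam := hl
      continuous_w := Complex.continuous_conj.comp c.continuous_w
      periodic_lam := fun t => by simp only [c.periodic_lam t]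
      periodic_w := fun t => by simp only [c.periodic_w t]
      lam_ne_zero := fun t => by simpa using c.lam_ne_zero t
      on_curve := fun t => by
        have := congrArg (starRingEnd ℂ) (c.on_curve t)
        simpa using this }
  have hI : c'.integral = starRingEnd ℂ c.integral := by
    have hint : IntervalIntegrable (fun t => c.w t / c.lam t ^ 2 * deriv c.lam t)
        MeasureTheory.volume 0 1 :=
      ((c.continuous_w.div (c.contDiff_lam.continuous.pow 2) fun t =>
        pow_ne_zero 2 (c.lam_ne_zero t)).mul
        (c.contDiff_lam.continuous_deriv le_rfl)).intervalIntegrable _ _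
    refine Eq.trans ?_ (Complex.conjCLE.toContinuousLinearMap.intervalIntegral_comp_comm hint)
    refine intervalIntegral.integral_congr fun t _ => ?_
    have hd : deriv c'.lam t = starRingEnd ℂ (deriv c.lam t) := by
      have := (c.contDiff_lam.differentiable one_ne_zero t).hasDerivAt
      exact (Complex.conjCLE.toContinuousLinearMap.hasFDerivAt.comp_hasDerivAt t this).deriv
    simp [c', hd]
  have h1 := h c'
  rw [hI] at h1
  have h2 : Complex.exp (((-φ : ℝ) : ℂ) * Complex.I) * c.integral =
      starRingEnd ℂ (Complex.exp (φ * Complex.I) * starRingEnd ℂ c.integral) := by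
    rw [map_mul, Complex.conj_conj, ← Complex.exp_conj]
    simp
  rw [h2, Complex.conj_im, h1, neg_zero]

/-! ### Consequences of the Boutroux equations -/

theorem Complex.im_exp_mul (φ : ℝ) (y : ℂ) :
    (Complex.exp (φ * Complex.I) * y).im = Real.cos φ * y.im + Real.sin φ * y.re := by
  rw [Complex.mul_im, Complex.exp_ofReal_mul_I_re, Complex.exp_ofReal_mul_I_im]

theorem Complex.re_exp_mul (φ : ℝ) (y : ℂ) :
    (Complex.exp (φ * Complex.I) * y).re = Real.cos φ * y.re - Real.sin φ * y.im := by
  rw [Complex.mul_re, Complex.exp_ofReal_mul_I_re, Complex.exp_ofReal_mul_I_im]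

theorem intervalIntegral_re {f : ℝ → ℂ} {a b : ℝ}
    (hf : IntervalIntegrable f MeasureTheory.volume a b) :
    (∫ t in a..b, f t).re = ∫ t in a..b, (f t).re :=
  (Complex.reCLM.intervalIntegral_comp_comm hf).symm

theorem intervalIntegral_im {f : ℝ → ℂ} {a b : ℝ}
    (hf : IntervalIntegrable f MeasureTheory.volume a b) :
    (∫ t in a..b, f t).im = ∫ t in a..b, (f t).im :=
  (Complex.imCLM.intervalIntegral_comp_comm hf).symm

noncomputable def circleV (a : ℂ) (t : ℝ) : ℂ :=
  (4 * (Real.sin (2 * Real.pi * t) : ℂ) ^ 2 + a).sqrt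

noncomputable def pairIntegral (a : ℂ) : ℂ :=
  ∫ t in (0 : ℝ)..1, (Real.sin (2 * Real.pi * t) : ℂ) ^ 2 / pairS a t

theorem four_mul_ofReal_sq_add_re (x : ℝ) (a : ℂ) : (4 * (x : ℂ) ^ 2 + a).re = 4 * x ^ 2 + a.re := by
  rw [Complex.add_re, show (4 * (x : ℂ) ^ 2) = ((4 * x ^ 2 : ℝ) : ℂ) by push_cast; rfl,
    Complex.ofReal_re]

theorem four_mul_ofReal_sq_add_im (x : ℝ) (a : ℂ) : (4 * (x : ℂ) ^ 2 + a).im = a.im := by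
  rw [Complex.add_im, show (4 * (x : ℂ) ^ 2) = ((4 * x ^ 2 : ℝ) : ℂ) by push_cast; rfl,
    Complex.ofReal_im, zero_add]

theorem continuous_circleV {a : ℂ} (ha : a.im ≠ 0) : Continuous (circleV a) := by
  refine continuous_iff_continuousAt.2 fun t => ?_
  refine ContinuousAt.comp (f := fun t : ℝ => 4 * (Real.sin (2 * Real.pi * t) : ℂ) ^ 2 + a)
    (Complex.continuousAt_sqrt (.inr ?_)) (by fun_prop)
  rwa [four_mul_ofReal_sq_add_im]

theorem periodic_sin_two_pi : Function.Periodic (fun t => Real.sin (2 * Real.pi * t)) 1 := fun t => by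
  simp only [mul_add, mul_one, Real.sin_add_two_pi]

theorem SolvesBoutroux.im_circleV {φ : ℝ} {a : ℂ} (h : SolvesBoutroux φ (a + 2)) (ha : a.im ≠ 0) :
    Real.cos φ * (∫ t in (0 : ℝ)..1, circleV a t).im +
      Real.sin φ * (∫ t in (0 : ℝ)..1, circleV a t).re = 0 := by
  rw [← Complex.im_exp_mul]
  refine h.im_circle (continuous_circleV ha) (fun t => ?_) fun t => Complex.sqrt_sq_self _
  simp only [circleV]
  rw [show Real.sin (2 * Real.pi * (t + 1)) = _ from periodic_sin_two_pi t]

theorem circleV_im_pos {a : ℂ} (ha : 0 < a.im) (t : ℝ) : 0 < (circleV a t).im :=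
  Complex.im_sqrt_pos (by rwa [four_mul_ofReal_sq_add_im])

theorem circleV_re_pos {a : ℂ} (ha : 0 < a.im) (t : ℝ) : 0 < (circleV a t).re :=
  Complex.re_sqrt_pos (Complex.mem_slitPlane_iff.2 (.inr (by
    rw [four_mul_ofReal_sq_add_im]; exact ha.ne')))

theorem four_add_mem_slitPlane_of_im_pos {a : ℂ} (ha : 0 < a.im) : 4 + a ∈ Complex.slitPlane :=
  Complex.mem_slitPlane_iff.2 (.inr (by simpa using ha.ne'))

theorem continuous_pairIntegrand {a : ℂ} (ha : 4 + a ∈ Complex.slitPlane) :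
    Continuous fun t : ℝ => (Real.sin (2 * Real.pi * t) : ℂ) ^ 2 / pairS a t :=
  (by fun_prop : Continuous fun t : ℝ => (Real.sin (2 * Real.pi * t) : ℂ) ^ 2).div
    (continuous_pairS ha) (pairS_ne_zero ha)

/-- If `Re a, Im a > 0` then `a / √(4 + c a)` lies in the first quadrant for real `c ≥ 0`. -/
theorem div_sqrt_four_add_mul {a : ℂ} (ha : 0 < a.im) (hr : 0 < a.re) {c : ℝ} (hc : 0 ≤ c) :
    0 < (a / (4 + c * a).sqrt).re ∧ 0 ≤ (a / (4 + c * a).sqrt).im := by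
  have him : (4 + c * a).im = c * a.im := by simp
  have hre : (4 + c * a).re = 4 + c * a.re := by simp
  have hcr : 0 ≤ c * a.re := mul_nonneg hc hr.le
  have hs : 4 + c * a ∈ Complex.slitPlane := Complex.mem_slitPlane_iff.2 (.inl (by rw [hre]; linarith))
  have hp := Complex.re_sqrt_pos hs
  have hq : 0 ≤ (4 + c * a).sqrt.im := Complex.im_sqrt_nonneg (by rw [him]; positivity)
  have hsq := (4 + c * a).sqrt_sq_self
  have h1 := congrArg Complex.re hsq
  have h2 := congrArg Complex.im hsq
  rw [hre] at h1
  rw [him] at h2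
  simp only [sq, Complex.mul_re, Complex.mul_im] at h1 h2
  have hn : 0 < Complex.normSq (4 + c * a).sqrt := Complex.normSq_pos.2
    (Complex.sqrt_ne_zero_of_ne_zero (Complex.slitPlane_ne_zero hs))
  generalize (4 + c * a).sqrt = s at *
  constructor
  · rw [Complex.div_re]
    positivity
  · rw [Complex.div_im, ← sub_div]
    refine div_nonneg ?_ hn.le
    have : 0 ≤ s.re * (a.im * s.re - a.re * s.im) := by nlinarith [mul_pos ha hp]
    exact nonneg_of_mul_nonneg_right this hp

/-- The circle integral lies in the open first quadrant, so `cos φ Im + sin φ Re = 0` needs `sin φ <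
0`. If also `Re a > 0`, the pair integral times `a` has positive real and nonnegative imaginary
part, and `cos φ Re - sin φ Im` could not vanish. -/
theorem SolvesBoutroux.neg_and_re_nonpos {φ : ℝ} {a : ℂ} (h : SolvesBoutroux φ (a + 2))
    (ha : 0 < a.im) (hφ : |φ| < Real.pi / 2) : φ < 0 ∧ a.re ≤ 0 := by
  obtain ⟨hφ1, hφ2⟩ := abs_lt.1 hφ
  have hcos : 0 < Real.cos φ := Real.cos_pos_of_mem_Ioo ⟨by linarith, hφ2⟩
  have h1 := h.im_circleV ha.ne'
  have hi := (continuous_circleV ha.ne').intervalIntegrable (μ := MeasureTheory.volume) 0 1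
  have hC1 : 0 < (∫ t in (0 : ℝ)..1, circleV a t).im := by
    rw [intervalIntegral_im hi]
    exact intervalIntegral.intervalIntegral_pos_of_pos
      ((Complex.continuous_im.comp (continuous_circleV ha.ne')).intervalIntegrable _ _)
      (circleV_im_pos ha) one_pos
  have hC2 : 0 < (∫ t in (0 : ℝ)..1, circleV a t).re := by
    rw [intervalIntegral_re hi]
    exact intervalIntegral.intervalIntegral_pos_of_pos
      ((Complex.continuous_re.comp (continuous_circleV ha.ne')).intervalIntegrable _ _)
      (circleV_re_pos ha) one_pos
  have hsin : Real.sin φ < 0 := by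
    by_contra! hs
    nlinarith [mul_pos hcos hC1, mul_nonneg hs hC2.le]
  have hneg : φ < 0 := by
    by_contra! h0
    exact absurd (Real.sin_nonneg_of_nonneg_of_le_pi h0 (by linarith)) (not_le.2 hsin)
  refine ⟨hneg, ?_⟩
  by_contra! hr
  have ha4 := four_add_mem_slitPlane_of_im_pos ha
  have h2 := h.re_pair ha4
  rw [Complex.re_exp_mul, ← intervalIntegral.integral_const_mul] at h2
  have hci : Continuous fun t : ℝ => a * ((Real.sin (2 * Real.pi * t) : ℂ) ^ 2 / pairS a t) :=
    continuous_const.mul (continuous_pairIntegrand ha4)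
  have hi2 := hci.intervalIntegrable (μ := MeasureTheory.volume) 0 1
  have hform : ∀ t : ℝ, a * ((Real.sin (2 * Real.pi * t) : ℂ) ^ 2 / pairS a t) =
      ((Real.sin (2 * Real.pi * t) ^ 2 : ℝ) : ℂ) *
        (a / (4 + ((Real.cos (2 * Real.pi * t) ^ 2 : ℝ) : ℂ) * a).sqrt) := fun t => by
    rw [pairS]; push_cast; ring
  have hR : 0 < (∫ t in (0 : ℝ)..1, a * ((Real.sin (2 * Real.pi * t) : ℂ) ^ 2 / pairS a t)).re := by
    rw [intervalIntegral_re hi2]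
    refine intervalIntegral.integral_pos one_pos (Complex.continuous_re.comp hci).continuousOn
      (fun t _ => ?_) ⟨1 / 4, by norm_num, ?_⟩
    · rw [hform, Complex.re_ofReal_mul]
      exact mul_nonneg (sq_nonneg _) (div_sqrt_four_add_mul ha hr (sq_nonneg _)).1.le
    · rw [hform, Complex.re_ofReal_mul]
      refine mul_pos ?_ (div_sqrt_four_add_mul ha hr (sq_nonneg _)).1
      rw [show 2 * Real.pi * (1 / 4) = Real.pi / 2 by ring, Real.sin_pi_div_two]
      norm_num
  have hI : 0 ≤ (∫ t in (0 : ℝ)..1, a * ((Real.sin (2 * Real.pi * t) : ℂ) ^ 2 / pairS a t)).im := by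
    rw [intervalIntegral_im hi2]
    refine intervalIntegral.integral_nonneg zero_le_one fun t _ => ?_
    rw [hform, Complex.im_ofReal_mul]
    exact mul_nonneg (sq_nonneg _) (div_sqrt_four_add_mul ha hr (sq_nonneg _)).2
  nlinarith [mul_pos hcos hR, mul_nonneg (neg_nonneg.2 hsin.le) hI]

/-- There are no real solutions `A` for small `φ < 0`, and no solutions in the lower half-plane. -/
theorem SolvesBoutroux.im_pos {φ : ℝ} {a : ℂ} (h : SolvesBoutroux φ (a + 2))
    (hφ : φ < 0) (hφ' : -(Real.pi / 2) < φ) : 0 < a.im := by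
  have hpi := Real.pi_pos
  have hcos : 0 < Real.cos φ := Real.cos_pos_of_mem_Ioo ⟨hφ', by linarith⟩
  have hsin : Real.sin φ < 0 := Real.sin_neg_of_neg_of_neg_pi_lt hφ (by linarith)
  have h14 : Real.sin (2 * Real.pi * (1 / 4)) = 1 := by
    rw [show 2 * Real.pi * (1 / 4) = Real.pi / 2 by ring, Real.sin_pi_div_two]
  by_contra! hneg
  rcases hneg.lt_or_eq with hneg | h0
  · have h' : SolvesBoutroux (-φ) (starRingEnd ℂ a + 2) := by
      simpa [map_ofNat] using h.conj
    have := (h'.neg_and_re_nonpos (by simpa using hneg) (by rw [abs_neg, abs_of_neg hφ]; linarith)).1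
    linarith
  obtain ⟨x, rfl⟩ : ∃ x : ℝ, a = x := ⟨a.re, Complex.ext rfl (by simpa using h0)⟩
  -- For real `a` one period is real or imaginary and nonzero: the circle period is real for `a ≥ 0`
  -- and imaginary for `a ≤ -4`; between them the pair equation would make a nonzero real number
  -- times `cos φ` vanish.
  rcases le_or_gt 0 x with hx | hx
  · have hn : ∀ t : ℝ, 0 ≤ 4 * Real.sin (2 * Real.pi * t) ^ 2 + x := fun t => by positivity
    have hc : Continuous fun t : ℝ => √(4 * Real.sin (2 * Real.pi * t) ^ 2 + x) := by fun_prop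
    have h1 := h.im_circle (V := fun t => ((√(4 * Real.sin (2 * Real.pi * t) ^ 2 + x) : ℝ) : ℂ))
      (Complex.continuous_ofReal.comp hc)
      (fun t => by simp only [show Real.sin (2 * Real.pi * (t + 1)) = _ from periodic_sin_two_pi t])
      (fun t => by rw [← Complex.ofReal_pow, Real.sq_sqrt (hn t)]; push_cast; rfl)
    rw [intervalIntegral.integral_ofReal, Complex.im_exp_mul, Complex.ofReal_im, Complex.ofReal_re,
      mul_zero, zero_add] at h1
    have : 0 < ∫ t in (0 : ℝ)..1, √(4 * Real.sin (2 * Real.pi * t) ^ 2 + x) := by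
      refine intervalIntegral.integral_pos one_pos hc.continuousOn (fun t _ => Real.sqrt_nonneg _)
        ⟨1 / 4, by norm_num, Real.sqrt_pos.2 ?_⟩
      rw [h14]; linarith
    nlinarith
  · rcases lt_or_ge (-4) x with hx4 | hx4
    · have hcs : ∀ t : ℝ, 0 < 4 + Real.cos (2 * Real.pi * t) ^ 2 * x := fun t => by
        nlinarith [Real.cos_sq_le_one (2 * Real.pi * t), sq_nonneg (Real.cos (2 * Real.pi * t))]
      have h1 := h.re_pair (Complex.mem_slitPlane_iff.2 (.inl (by simp; linarith)))
      have hc : Continuous fun t : ℝ => Real.sin (2 * Real.pi * t) ^ 2 /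
          √(4 + Real.cos (2 * Real.pi * t) ^ 2 * x) :=
        Continuous.div (by fun_prop) (by fun_prop) fun t => (Real.sqrt_pos.2 (hcs t)).ne'
      have hI : ∫ t in (0 : ℝ)..1, (Real.sin (2 * Real.pi * t) : ℂ) ^ 2 / pairS x t =
          ((∫ t in (0 : ℝ)..1, Real.sin (2 * Real.pi * t) ^ 2 /
            √(4 + Real.cos (2 * Real.pi * t) ^ 2 * x) : ℝ) : ℂ) := by
        rw [← intervalIntegral.integral_ofReal]
        refine intervalIntegral.integral_congr fun t _ => ?_
        have e : (4 + (Real.cos (2 * Real.pi * t) : ℂ) ^ 2 * x) =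
          ((4 + Real.cos (2 * Real.pi * t) ^ 2 * x : ℝ) : ℂ) := by push_cast; rfl
        simp only [pairS]
        rw [e, Complex.sqrt_of_nonneg (Complex.zero_le_real.2 (hcs t).le), Complex.ofReal_re]
        push_cast; rfl
      have hpos : 0 < ∫ t in (0 : ℝ)..1, Real.sin (2 * Real.pi * t) ^ 2 /
            √(4 + Real.cos (2 * Real.pi * t) ^ 2 * x) := by
        refine intervalIntegral.integral_pos one_pos hc.continuousOn (fun t _ => by positivity)
          ⟨1 / 4, by norm_num, ?_⟩
        have := Real.sqrt_pos.2 (hcs (1 / 4))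
        rw [h14]; positivity
      rw [hI, ← Complex.ofReal_mul, Complex.re_exp_mul, Complex.ofReal_im, Complex.ofReal_re,
        mul_zero, sub_zero] at h1
      exact mul_ne_zero hcos.ne' (mul_ne_zero hx.ne hpos.ne') h1
    · have hn : ∀ t : ℝ, 0 ≤ -(4 * Real.sin (2 * Real.pi * t) ^ 2 + x) := fun t => by
        nlinarith [Real.sin_sq_le_one (2 * Real.pi * t)]
      have hc : Continuous fun t : ℝ => √(-(4 * Real.sin (2 * Real.pi * t) ^ 2 + x)) := by fun_prop
      have h1 := h.im_circle
        (V := fun t => Complex.I * ((√(-(4 * Real.sin (2 * Real.pi * t) ^ 2 + x)) : ℝ) : ℂ))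
        (continuous_const.mul (Complex.continuous_ofReal.comp hc))
        (fun t => by simp only [show Real.sin (2 * Real.pi * (t + 1)) = _ from periodic_sin_two_pi t])
        (fun t => by
          rw [mul_pow, ← Complex.ofReal_pow, Real.sq_sqrt (hn t), Complex.I_sq]; push_cast; ring)
      rw [intervalIntegral.integral_const_mul, intervalIntegral.integral_ofReal,
        Complex.im_exp_mul, Complex.I_mul_im, Complex.I_mul_re, Complex.ofReal_im,
        Complex.ofReal_re, neg_zero, mul_zero, add_zero] at h1
      have : 0 < ∫ t in (0 : ℝ)..1, √(-(4 * Real.sin (2 * Real.pi * t) ^ 2 + x)) := by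
        refine intervalIntegral.integral_pos one_pos hc.continuousOn (fun t _ => Real.sqrt_nonneg _)
          ⟨0, by norm_num, Real.sqrt_pos.2 ?_⟩
        rw [mul_zero, Real.sin_zero]; linarith
      exact mul_ne_zero hcos.ne' this.ne' h1

/-! ### Solutions for small angles -/

theorem half_sqrt_norm_le_im_circleV {a : ℂ} (ha : 0 < a.im) (hr : a.re ≤ 0) {t : ℝ}
    (ht : 4 * Real.sin (2 * Real.pi * t) ^ 2 ≤ ‖a‖ / 4) : √‖a‖ / 2 ≤ (circleV a t).im := by
  have hre := four_mul_ofReal_sq_add_re (Real.sin (2 * Real.pi * t)) a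
  have him := four_mul_ofReal_sq_add_im (Real.sin (2 * Real.pi * t)) a
  have hn : ‖a‖ - 4 * Real.sin (2 * Real.pi * t) ^ 2 ≤
      ‖4 * (Real.sin (2 * Real.pi * t) : ℂ) ^ 2 + a‖ := by
    have h1 := norm_sub_le (4 * (Real.sin (2 * Real.pi * t) : ℂ) ^ 2 + a)
      (4 * (Real.sin (2 * Real.pi * t) : ℂ) ^ 2)
    have h2 : ‖(4 * (Real.sin (2 * Real.pi * t) : ℂ) ^ 2)‖ = 4 * Real.sin (2 * Real.pi * t) ^ 2 := by
      rw [norm_mul, norm_pow, Complex.norm_real, Real.norm_eq_abs, sq_abs]; norm_num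
    rw [add_sub_cancel_left, h2] at h1
    linarith
  rw [circleV, Complex.sqrt, Complex.cpow_inv_two_im_eq_sqrt (by rw [him]; exact ha.le)]
  refine Real.le_sqrt_of_sq_le ?_
  rw [div_pow, Real.sq_sqrt (norm_nonneg _), hre]
  linarith

/-- If `|a| ≥ δ`, then `Im C ≥ τ √|a| / 2` and `|C| ≤ √|a| √(4/δ + 1)`. Both bounds scale like
`√|a|`, so the contradiction for small `φ` needs no upper bound on `|a|`. -/
theorem SolvesBoutroux.norm_lt_of_im_pos {δ : ℝ} (hδ : 0 < δ) :
    ∃ η > 0, ∀ (φ : ℝ) (a : ℂ), |φ| < η → 0 < a.im → SolvesBoutroux φ (a + 2) → ‖a‖ < δ := by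
  -- For `t ≤ τ` this gives `2πt ≤ √δ / 4`, hence `4 sin² ≤ δ / 4 ≤ |a| / 4`.
  set τ : ℝ := min 1 (√δ / (8 * Real.pi)) with hτ
  have hpi := Real.pi_pos
  have hτ0 : 0 < τ := lt_min one_pos (by positivity)
  have hτ1 : τ ≤ 1 := min_le_left _ _
  have hK : 0 < √(4 / δ + 1) := Real.sqrt_pos.2 (by positivity)
  refine ⟨min 1 (τ / (4 * √(4 / δ + 1))), lt_min one_pos (by positivity), fun φ a hφ ha h => ?_⟩
  have hφ1 : |φ| < 1 := hφ.trans_le (min_le_left _ _)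
  have hφ2 : |φ| < τ / (4 * √(4 / δ + 1)) := hφ.trans_le (min_le_right _ _)
  by_contra! hle
  have hn0 : 0 < ‖a‖ := hδ.trans_le hle
  obtain ⟨-, hr⟩ := h.neg_and_re_nonpos ha (hφ1.trans (by linarith [Real.pi_gt_three]))
  have hcos : 1 / 2 ≤ Real.cos φ := by
    have := Real.one_sub_sq_div_two_le_cos (x := φ)
    have : φ ^ 2 < 1 := (sq_lt_one_iff_abs_lt_one φ).2 hφ1
    linarith
  have hc := continuous_circleV ha.ne'
  have hci : Continuous fun t => (circleV a t).im := Complex.continuous_im.comp hc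
  have hlow : τ * (√‖a‖ / 2) ≤ (∫ t in (0 : ℝ)..1, circleV a t).im := by
    rw [intervalIntegral_im (hc.intervalIntegrable _ _),
      ← intervalIntegral.integral_add_adjacent_intervals (hci.intervalIntegrable 0 τ)
        (hci.intervalIntegrable τ 1)]
    have h1 : τ * (√‖a‖ / 2) ≤ ∫ t in (0 : ℝ)..τ, (circleV a t).im := by
      have := intervalIntegral.integral_mono_on (μ := MeasureTheory.volume) hτ0.le
        (f := fun _ => √‖a‖ / 2) intervalIntegrable_const (hci.intervalIntegrable 0 τ)
        fun t ht => half_sqrt_norm_le_im_circleV ha hr ?_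
      · simpa [mul_div_assoc] using this
      have h2 : |Real.sin (2 * Real.pi * t)| ≤ 2 * Real.pi * t := by
        have := Real.abs_sin_le_abs (x := 2 * Real.pi * t)
        rwa [abs_of_nonneg (mul_nonneg (by positivity) ht.1)] at this
      have h3 : 2 * Real.pi * t ≤ √δ / 4 := by
        have : t ≤ √δ / (8 * Real.pi) := ht.2.trans (min_le_right _ _)
        rw [le_div_iff₀ (by positivity)] at this
        linarith
      have h4 : Real.sin (2 * Real.pi * t) ^ 2 ≤ (√δ / 4) ^ 2 := by
        rw [← sq_abs (Real.sin _)]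
        exact pow_le_pow_left₀ (abs_nonneg _) (h2.trans h3) 2
      rw [div_pow, Real.sq_sqrt hδ.le] at h4
      linarith
    have h2 : 0 ≤ ∫ t in τ..1, (circleV a t).im :=
      intervalIntegral.integral_nonneg hτ1 fun t _ => (circleV_im_pos ha t).le
    linarith
  have hup : ‖∫ t in (0 : ℝ)..1, circleV a t‖ ≤ √‖a‖ * √(4 / δ + 1) := by
    have := intervalIntegral.norm_integral_le_of_norm_le_const (a := 0) (b := 1)
      (f := circleV a) (C := √‖a‖ * √(4 / δ + 1)) fun t _ => ?_
    · simpa using this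
    rw [circleV, Complex.norm_sqrt_eq, ← Real.sqrt_mul (norm_nonneg _)]
    refine Real.sqrt_le_sqrt ((norm_add_le _ _).trans ?_)
    rw [norm_mul, norm_pow, Complex.norm_real, Real.norm_eq_abs, sq_abs]
    have h1 := Real.sin_sq_le_one (2 * Real.pi * t)
    have h2 : 4 ≤ ‖a‖ * (4 / δ) := by
      rw [mul_div_assoc', le_div_iff₀ hδ]; linarith
    norm_num
    linarith
  have heq := h.im_circleV ha.ne'
  have h1 : Real.cos φ * (∫ t in (0 : ℝ)..1, circleV a t).im ≤
      |φ| * (√‖a‖ * √(4 / δ + 1)) := by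
    have h2 : |Real.sin φ * (∫ t in (0 : ℝ)..1, circleV a t).re| ≤
        |φ| * (√‖a‖ * √(4 / δ + 1)) := by
      rw [abs_mul]
      exact mul_le_mul Real.abs_sin_le_abs ((Complex.abs_re_le_norm _).trans hup) (abs_nonneg _)
        (abs_nonneg _)
    linarith [neg_abs_le (Real.sin φ * (∫ t in (0 : ℝ)..1, circleV a t).re)]
  have hs : 0 < √‖a‖ := Real.sqrt_pos.2 hn0
  rw [lt_div_iff₀ (by positivity)] at hφ2
  have h3 : 1 / 2 * (τ * (√‖a‖ / 2)) ≤ Real.cos φ * (∫ t in (0 : ℝ)..1, circleV a t).im :=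
    mul_le_mul hcos hlow (by positivity) (by linarith)
  nlinarith

/-! ### The limiting argument of `a` -/

theorem continuousAt_pairIntegral : ContinuousAt pairIntegral 0 := by
  refine continuousAt_intervalIntegral_param
    (F := fun a t => (Real.sin (2 * Real.pi * t) : ℂ) ^ 2 / pairS a t) (fun a => ?_) fun t _ => ?_
  · exact Measurable.div (by fun_prop) (Complex.measurable_sqrt.comp (by fun_prop))
  · simp only [Function.uncurry_def, pairS]
    have h0 : (4 + (Real.cos (2 * Real.pi * t) : ℂ) ^ 2 * 0) ∈ Complex.slitPlane := by
      rw [mul_zero, add_zero]; exact Complex.ofNat_mem_slitPlane 4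
    refine ContinuousAt.div (by fun_prop) ?_
      (Complex.sqrt_ne_zero_of_ne_zero (Complex.slitPlane_ne_zero h0))
    exact ContinuousAt.comp (f := fun p : ℂ × ℝ => 4 + (Real.cos (2 * Real.pi * p.2) : ℂ) ^ 2 * p.1)
      (x := (0, t)) (Complex.differentiableAt_sqrt h0).continuousAt (by fun_prop)

theorem Complex.sqrt_four : (4 : ℂ).sqrt = 2 := by
  have h : √(4 : ℝ) = 2 := by rw [show (4 : ℝ) = 2 ^ 2 by norm_num]; exact Real.sqrt_sq (by norm_num)
  rw [show (4 : ℂ) = ((4 : ℝ) : ℂ) by norm_num,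
    Complex.sqrt_of_nonneg (Complex.zero_le_real.2 (by norm_num)), Complex.ofReal_re, h]
  norm_num

theorem exists_pairIntegral_zero : ∃ c : ℝ, 0 < c ∧ pairIntegral 0 = c := by
  refine ⟨∫ t in (0 : ℝ)..1, Real.sin (2 * Real.pi * t) ^ 2 / 2, ?_, ?_⟩
  · refine intervalIntegral.integral_pos one_pos (by fun_prop) (fun t _ => by positivity)
      ⟨1 / 4, by norm_num, ?_⟩
    rw [show 2 * Real.pi * (1 / 4) = Real.pi / 2 by ring, Real.sin_pi_div_two]; norm_num
  · rw [← intervalIntegral.integral_ofReal]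
    refine intervalIntegral.integral_congr fun t _ => ?_
    simp only [pairS, mul_zero, add_zero, Complex.sqrt_four]
    push_cast; rfl

/-- If `k` is close to the positive number `c`, then `Re (a k) = 0` makes `a` nearly imaginary,
because `c Re a = -Re (a (k - c))`. -/
theorem abs_re_div_norm_le {a k : ℂ} {c : ℝ} (hc : 0 < c) (ha : a ≠ 0) (h : (a * k).re = 0) :
    |a.re / ‖a‖| ≤ ‖k - c‖ / c := by
  have hn : 0 < ‖a‖ := norm_pos_iff.2 ha
  rw [abs_div, abs_norm, div_le_div_iff₀ hn hc]
  have e : a.re * c = -(a * (k - c)).re := by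
    rw [mul_sub, Complex.sub_re, h, Complex.re_mul_ofReal]; ring
  calc |a.re| * c = |a.re * c| := by rw [abs_mul, abs_of_pos hc]
    _ = |(a * (k - c)).re| := by rw [e, abs_neg]
    _ ≤ ‖a * (k - c)‖ := Complex.abs_re_le_norm _
    _ = ‖k - c‖ * ‖a‖ := by rw [norm_mul, mul_comm]

section

variable {X : Type*} {l : Filter X} {φ : X → ℝ} {a : X → ℂ}

theorem tendsto_zero_of_solvesBoutroux (hφ : Tendsto φ l (𝓝 0))
    (hB : ∀ᶠ x in l, SolvesBoutroux (φ x) (a x + 2)) (him : ∀ᶠ x in l, 0 < (a x).im) :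
    Tendsto a l (𝓝 0) := by
  refine Metric.tendsto_nhds.2 fun δ hδ => ?_
  obtain ⟨η, hη, h⟩ := SolvesBoutroux.norm_lt_of_im_pos hδ
  filter_upwards [hB, him, Metric.tendsto_nhds.1 hφ η hη] with x h1 h2 h3
  rw [dist_zero_right]
  exact h _ _ (by simpa using h3) h2 h1

theorem tendsto_arg_of_solvesBoutroux (hφ : Tendsto φ l (𝓝 0))
    (hB : ∀ᶠ x in l, SolvesBoutroux (φ x) (a x + 2)) (him : ∀ᶠ x in l, 0 < (a x).im) :
    Tendsto (fun x => (a x).arg) l (𝓝 (Real.pi / 2)) := by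
  have h0 := tendsto_zero_of_solvesBoutroux hφ hB him
  obtain ⟨c, hc, hc'⟩ := exists_pairIntegral_zero
  have hk : Tendsto (fun x => Complex.exp (φ x * Complex.I) * pairIntegral (a x)) l (𝓝 c) := by
    have h1 : Tendsto (fun x => Complex.exp (φ x * Complex.I)) l (𝓝 1) := by
      have : Continuous fun φ : ℝ => Complex.exp (φ * Complex.I) := by fun_prop
      simpa [Function.comp_def] using (this.tendsto 0).comp hφ
    have h2 := continuousAt_pairIntegral.tendsto.comp h0
    rw [hc'] at h2
    simpa using h1.mul h2
  have hlim : Tendsto (fun x => (a x).re / ‖a x‖) l (𝓝 0) := by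
    refine squeeze_zero_norm' ?_ (by
      simpa using ((hk.sub_const (c : ℂ)).norm.div_const c) :
        Tendsto (fun x => ‖Complex.exp (φ x * Complex.I) * pairIntegral (a x) - c‖ / c) l (𝓝 0))
    filter_upwards [hB, him] with x h1 h2
    refine abs_re_div_norm_le hc (ne_zero_of_im_pos h2) ?_
    rw [mul_left_comm]
    exact h1.re_pair (four_add_mem_slitPlane_of_im_pos h2)
  have hac := (Real.continuous_arccos.tendsto 0).comp hlim
  rw [Real.arccos_zero] at hac
  refine hac.congr' ?_
  filter_upwards [him] with x hx
  rw [Complex.arg_of_im_nonneg_of_ne_zero hx.le (ne_zero_of_im_pos hx)]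
  rfl

end

theorem eventually_im_pos_of_solvesBoutroux {a : ℝ → ℂ}
    (hB : ∀ᶠ φ in 𝓝[≠] 0, SolvesBoutroux φ (a φ + 2)) : ∀ᶠ φ in 𝓝[<] 0, 0 < (a φ).im := by
  have h1 : ∀ᶠ φ in 𝓝[<] (0 : ℝ), SolvesBoutroux φ (a φ + 2) :=
    hB.filter_mono (nhdsWithin_mono 0 fun x (hx : x < 0) => hx.ne)
  have hpi : -(Real.pi / 2) < 0 := by linarith [Real.pi_pos]
  filter_upwards [h1, Ioo_mem_nhdsLT hpi] with φ h hφ using h.im_pos hφ.2 hφ.1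

theorem eventually_im_neg_of_solvesBoutroux {a : ℝ → ℂ}
    (hB : ∀ᶠ φ in 𝓝[≠] 0, SolvesBoutroux φ (a φ + 2)) : ∀ᶠ φ in 𝓝[>] 0, (a φ).im < 0 := by
  have h1 : ∀ᶠ φ in 𝓝[>] (0 : ℝ), SolvesBoutroux φ (a φ + 2) :=
    hB.filter_mono (nhdsWithin_mono 0 fun x (hx : 0 < x) => hx.ne')
  have hpi : 0 < Real.pi / 2 := by linarith [Real.pi_pos]
  filter_upwards [h1, Ioo_mem_nhdsGT hpi] with φ h hφ
  have h' : SolvesBoutroux (-φ) (starRingEnd ℂ (a φ) + 2) := by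
    simpa [map_ofNat] using h.conj
  simpa using h'.im_pos (by linarith [hφ.1]) (by linarith [hφ.2])

theorem tendsto_of_solvesBoutroux_left {a : ℝ → ℂ}
    (hB : ∀ᶠ φ in 𝓝[≠] 0, SolvesBoutroux φ (a φ + 2)) :
    Tendsto a (𝓝[<] 0) (𝓝 0) ∧ Tendsto (fun φ => (a φ).arg) (𝓝[<] 0) (𝓝 (Real.pi / 2)) := by
  have hφ : Tendsto (fun φ : ℝ => φ) (𝓝[<] 0) (𝓝 0) := tendsto_id.mono_left nhdsWithin_le_nhds
  have h1 : ∀ᶠ φ in 𝓝[<] (0 : ℝ), SolvesBoutroux φ (a φ + 2) :=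
    hB.filter_mono (nhdsWithin_mono 0 fun x (hx : x < 0) => hx.ne)
  have h2 := eventually_im_pos_of_solvesBoutroux hB
  exact ⟨tendsto_zero_of_solvesBoutroux hφ h1 h2, tendsto_arg_of_solvesBoutroux hφ h1 h2⟩

theorem tendsto_of_solvesBoutroux_right {a : ℝ → ℂ}
    (hB : ∀ᶠ φ in 𝓝[≠] 0, SolvesBoutroux φ (a φ + 2)) :
    Tendsto a (𝓝[>] 0) (𝓝 0) ∧ Tendsto (fun φ => (a φ).arg) (𝓝[>] 0) (𝓝 (-(Real.pi / 2))) := by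
  have hφ : Tendsto (fun φ : ℝ => -φ) (𝓝[>] 0) (𝓝 0) := by
    have : Tendsto (fun φ : ℝ => φ) (𝓝[>] 0) (𝓝 0) := tendsto_id.mono_left nhdsWithin_le_nhds
    simpa using this.neg
  have h1 : ∀ᶠ φ in 𝓝[>] (0 : ℝ), SolvesBoutroux (-φ) (starRingEnd ℂ (a φ) + 2) := by
    filter_upwards [hB.filter_mono (nhdsWithin_mono 0 fun x (hx : 0 < x) => hx.ne')] with φ h
    simpa [map_ofNat] using h.conj
  have hneg := eventually_im_neg_of_solvesBoutroux hB
  have h2 : ∀ᶠ φ in 𝓝[>] (0 : ℝ), 0 < (starRingEnd ℂ (a φ)).im :=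
    hneg.mono fun φ h => by simpa using h
  constructor
  · have := (Complex.continuous_conj.tendsto 0).comp (tendsto_zero_of_solvesBoutroux hφ h1 h2)
    simpa [Function.comp_def] using this
  · refine (tendsto_arg_of_solvesBoutroux hφ h1 h2).neg.congr' ?_
    filter_upwards [hneg] with φ h
    rw [Complex.arg_conj, if_neg, neg_neg]
    intro h3
    rw [Complex.arg_eq_pi_iff] at h3
    exact h.ne h3.2

theorem tendsto_of_solvesBoutroux {a : ℝ → ℂ}
    (hB : ∀ᶠ φ in 𝓝[≠] 0, SolvesBoutroux φ (a φ + 2)) : Tendsto a (𝓝[≠] 0) (𝓝 0) := by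
  rw [← nhdsLT_sup_nhdsGT]
  exact (tendsto_of_solvesBoutroux_left hB).1.sup (tendsto_of_solvesBoutroux_right hB).1

/-! ### Branch points -/

theorem IsBranchPair.sq_add_sq {A l₁ l₂ : ℂ} (h : IsBranchPair A l₁ l₂) :
    l₁ ^ 2 + l₂ ^ 2 = A ∧ (l₁ * l₂) ^ 2 = 1 := by
  have h0 := h.1 0
  have h1 := h.1 1
  have e0 : (l₁ * l₂) ^ 2 = 1 := by linear_combination -h0
  exact ⟨by linear_combination h1 + e0, e0⟩

/-- If `A` is close to `2` then the two branch points satisfy `l₁ l₂ = 1`. -/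
theorem IsBranchPair.mul_eq_one {a l₁ l₂ : ℂ} (h : IsBranchPair (a + 2) l₁ l₂) (ha : ‖a‖ < 1) :
    l₁ * l₂ = 1 := by
  obtain ⟨h1, h2⟩ := h.sq_add_sq
  obtain ⟨-, r1, r2⟩ := h
  rcases sq_eq_one_iff.1 h2 with h3 | h3
  · exact h3
  · exfalso
    have hre := congrArg Complex.re h3
    have him := congrArg Complex.im h3
    simp at hre him
    -- From `l₁ |l₂|² = -conj l₂`. With nonnegative real parts this puts both roots on the imaginary
    -- axis, where `l₁ l₂ = -1` forces `a ≤ -4`.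
    have hsum : l₁.re * l₂.im ^ 2 + l₁.re * l₂.re ^ 2 + l₂.re = 0 := by
      linear_combination l₂.im * him + l₂.re * hre
    have hx2 : l₂.re = 0 := by
      linarith [mul_nonneg r1 (sq_nonneg l₂.im), mul_nonneg r1 (sq_nonneg l₂.re)]
    have hx1 : l₁.re = 0 := by linarith
    rw [hx1, hx2] at hre
    have e : a.re = -(l₁.im + l₂.im) ^ 2 := by
      have := congrArg Complex.re (show a = (l₁ + l₂) ^ 2 by linear_combination -2 * h3 - h1)
      rw [this, sq, Complex.mul_re, Complex.add_re, Complex.add_im, hx1, hx2]; ring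
    have := (Complex.abs_re_le_norm a).trans_lt ha
    rw [e, abs_neg, abs_of_nonneg (sq_nonneg _)] at this
    nlinarith [sq_nonneg (l₁.im - l₂.im)]

theorem IsBranchPair.sub_sq {a l₁ l₂ : ℂ} (h : IsBranchPair (a + 2) l₁ l₂) (h1 : l₁ * l₂ = 1) :
    (l₂ - l₁) ^ 2 = a := by
  linear_combination h.sq_add_sq.1 - 2 * h1

/-- For the midpoint `u`, `l₁ l₂ = 1` gives `(u - 1)(u + 1) = ((l₂ - l₁)/2)²`, and `Re u ≥ 0` keeps
`|u + 1| ≥ 1`. -/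
theorem IsBranchPair.norm_half_add_sub_one_le {a l₁ l₂ : ℂ} (h : IsBranchPair (a + 2) l₁ l₂)
    (h1 : l₁ * l₂ = 1) : ‖(l₁ + l₂) / 2 - 1‖ ≤ (‖l₂ - l₁‖ / 2) ^ 2 := by
  have hr := h.2
  have e : ((l₁ + l₂) / 2 - 1) * ((l₁ + l₂) / 2 + 1) = ((l₂ - l₁) / 2) ^ 2 := by
    linear_combination h1
  have h2 : 1 ≤ ‖(l₁ + l₂) / 2 + 1‖ := by
    refine le_trans ?_ (Complex.re_le_norm _)
    have : ((l₁ + l₂) / 2 + 1).re = (l₁.re + l₂.re) / 2 + 1 := by simp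
    rw [this]; linarith
  have h3 := congrArg norm e
  rw [norm_mul, norm_pow, norm_div, Complex.norm_ofNat] at h3
  nlinarith [norm_nonneg ((l₁ + l₂) / 2 - 1)]

theorem IsBranchPair.arg_sub {a l₁ l₂ : ℂ} (h : IsBranchPair (a + 2) l₁ l₂) (h1 : l₁ * l₂ = 1)
    (ha : a.im ≠ 0) : (l₂ - l₁).arg = a.arg / 2 := by
  have hsq := h.sub_sq h1
  have hre : 0 ≤ (l₂ - l₁).re := by rw [Complex.sub_re]; linarith [h.2.2]
  generalize l₂ - l₁ = d at *
  have hre' : 0 < d.re := by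
    refine lt_of_le_of_ne hre fun h0 => ha ?_
    rw [← hsq, sq, Complex.mul_im, ← h0]; ring
  have hd0 : d ≠ 0 := by rintro rfl; simp at hre'
  have h3 := abs_lt.1 (Complex.abs_arg_lt_pi_div_two_iff.2 (.inl hre'))
  rw [← hsq, sq, Complex.arg_mul hd0 hd0 ⟨by linarith [h3.1], by linarith [h3.2]⟩]
  ring

/-! ### Existence of solutions -/

/-- This is `chartMean` at the tip, with `a / a` cancelled so that it is holomorphic at `a = 0`. -/
noncomputable def tipIntegral (a : ℂ) : ℂ :=
  ∫ r in (0 : ℝ)..1, (1 - (r : ℂ) ^ 2).sqrt / (1 - (r : ℂ) ^ 2 * a / (-4)).sqrt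

noncomputable def quarterIntegral (a : ℂ) : ℂ :=
  ∫ τ in (0 : ℝ)..(Real.pi / 2), (4 * (Real.sin τ : ℂ) ^ 2 + a).sqrt

theorem chartMean_tip {a : ℂ} (ha : a ≠ 0) : chartMean a (-4) a = tipIntegral a := by
  refine intervalIntegral.integral_congr fun r _ => ?_
  simp only [chartIntegrand]
  rw [mul_div_cancel_right₀ _ ha]

/-- At the tip the squared primitive is `(i a T(a) / 2)²`; the factor `i` converts the imaginary
part into a real part. -/
theorem chartImSq_tip_eq_zero {φ : ℝ} {a : ℂ} (ha : a ≠ 0)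
    (h : (Complex.exp (φ * Complex.I) * (a * tipIntegral a)).re = 0) :
    chartImSq φ a (-4) a = 0 := by
  have e : a / (-4) * (a * chartMean a (-4) a ^ 2) =
      (((1 / 2 : ℝ) : ℂ) * (Complex.I * (a * tipIntegral a))) ^ 2 := by
    rw [chartMean_tip ha]
    push_cast
    linear_combination (-(1 / 4) * a ^ 2 * tipIntegral a ^ 2) * Complex.I_sq
  rw [chartImSq, e, ← im_exp_mul_sq, mul_left_comm, Complex.im_ofReal_mul, mul_left_comm,
    Complex.I_mul_im, h]
  norm_num

theorem tip_mem_slitPlane {a : ℂ} (ha : ‖a‖ < 1) {r : ℝ} (hr : r ∈ Set.Icc (0 : ℝ) 1) :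
    1 - (r : ℂ) ^ 2 * a / (-4) ∈ Complex.slitPlane := by
  rw [sub_eq_add_neg]
  refine Complex.mem_slitPlane_of_norm_lt_one ?_
  rw [norm_neg, norm_div, norm_mul, norm_pow, Complex.norm_real, norm_neg, Complex.norm_ofNat,
    Real.norm_of_nonneg hr.1]
  have : r ^ 2 ≤ 1 := pow_le_one₀ hr.1 hr.2
  nlinarith [norm_nonneg a]

theorem differentiableAt_tipIntegral {a : ℂ} (ha : ‖a‖ < 1) : DifferentiableAt ℂ tipIntegral a := by
  have hI : Set.uIcc (0 : ℝ) 1 = Set.Icc 0 1 := Set.uIcc_of_le zero_le_one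
  have hS : ∀ r : ℝ, Continuous fun a : ℂ => 1 - (r : ℂ) ^ 2 * a / (-4) := fun r => by fun_prop
  have hmS : ∀ a : ℂ, Measurable fun r : ℝ => (1 - (r : ℂ) ^ 2 * a / (-4)).sqrt := fun a =>
    Complex.measurable_sqrt.comp (by fun_prop)
  have hm1 : Measurable fun r : ℝ => (1 - (r : ℂ) ^ 2).sqrt :=
    Complex.measurable_sqrt.comp (by fun_prop)
  have hc1 : ∀ r ∈ Set.Icc (0 : ℝ) 1, ContinuousAt (fun r : ℝ => (1 - (r : ℂ) ^ 2).sqrt) r := by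
    intro r hr
    refine ContinuousAt.comp (f := fun r : ℝ => 1 - (r : ℂ) ^ 2) (Complex.continuousAt_sqrt
      (.inl ?_)) (by fun_prop)
    have : r ^ 2 ≤ 1 := pow_le_one₀ hr.1 hr.2
    simpa [← Complex.ofReal_pow] using this
  have hc2 : ∀ r ∈ Set.Icc (0 : ℝ) 1, ContinuousAt
      (fun p : ℂ × ℝ => (1 - (p.2 : ℂ) ^ 2 * p.1 / (-4)).sqrt) (a, r) := fun r hr =>
    ContinuousAt.comp (f := fun p : ℂ × ℝ => 1 - (p.2 : ℂ) ^ 2 * p.1 / (-4)) (x := (a, r))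
      (Complex.differentiableAt_sqrt (tip_mem_slitPlane ha hr)).continuousAt (by fun_prop)
  have h0 : ∀ {a : ℂ}, ‖a‖ < 1 → ∀ r ∈ Set.Icc (0 : ℝ) 1,
      (1 - (r : ℂ) ^ 2 * a / (-4)).sqrt ≠ 0 := fun ha r hr =>
    Complex.sqrt_ne_zero_of_ne_zero (Complex.slitPlane_ne_zero (tip_mem_slitPlane ha hr))
  refine (hasDerivAt_intervalIntegral_param
    (F := fun a r => (1 - (r : ℂ) ^ 2).sqrt / (1 - (r : ℂ) ^ 2 * a / (-4)).sqrt)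
    (F' := fun a r => (1 - (r : ℂ) ^ 2).sqrt * (-(1 / (2 * (1 - (r : ℂ) ^ 2 * a / (-4)).sqrt) *
      ((r : ℂ) ^ 2 / 4)) / (1 - (r : ℂ) ^ 2 * a / (-4)).sqrt ^ 2))
    (fun a => hm1.div (hmS a)) (fun a => ?_) ?_ ?_ ?_).differentiableAt
  · exact hm1.mul ((((measurable_const.div ((hmS a).const_mul 2)).mul (by fun_prop)).neg).div
      ((hmS a).pow_const 2))
  · intro r hr
    rw [hI] at hr
    have h2 := hc2 r hr
    have hne := h0 ha r hr
    have h1 : ContinuousAt (fun p : ℂ × ℝ => (1 - (p.2 : ℂ) ^ 2).sqrt) (a, r) :=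
      (hc1 r hr).comp_of_eq (continuousAt_snd (p := (a, r))) rfl
    exact h1.mul ((((continuousAt_const.div (continuousAt_const.mul h2)
      (mul_ne_zero two_ne_zero hne)).mul (by fun_prop)).neg).div (h2.pow 2) (pow_ne_zero 2 hne))
  · intro r hr
    rw [hI] at hr
    have h2 : ContinuousAt (fun r : ℝ => (1 - (r : ℂ) ^ 2 * a / (-4)).sqrt) r :=
      ContinuousAt.comp (f := fun r : ℝ => (a, r)) (hc2 r hr) (by fun_prop)
    exact ((hc1 r hr).div h2 (h0 ha r hr)).continuousWithinAt
  · filter_upwards [(isOpen_lt continuous_norm continuous_const).mem_nhds ha] with x hx r hr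
    rw [hI] at hr
    have hl : HasDerivAt (fun a : ℂ => 1 - (r : ℂ) ^ 2 * a / (-4)) ((r : ℂ) ^ 2 / 4) x := by
      have := (((hasDerivAt_id' x).const_mul ((r : ℂ) ^ 2)).div_const (-4)).const_sub 1
      refine this.congr_deriv ?_
      ring
    have h1 := ((Complex.hasDerivAt_sqrt' (tip_mem_slitPlane hx hr)).comp x hl)
    have h2 := (h1.fun_inv (h0 hx r hr)).const_mul ((1 - (r : ℂ) ^ 2).sqrt)
    simpa only [div_eq_mul_inv _ (Complex.sqrt _), Function.comp_def] using h2

theorem exists_tipIntegral_zero : ∃ c : ℝ, 0 < c ∧ tipIntegral 0 = c := by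
  refine ⟨∫ r in (0 : ℝ)..1, √(1 - r ^ 2), ?_, ?_⟩
  · exact intervalIntegral.integral_pos one_pos (by fun_prop) (fun t _ => Real.sqrt_nonneg _)
      ⟨0, by norm_num, by norm_num⟩
  · rw [← intervalIntegral.integral_ofReal]
    refine intervalIntegral.integral_congr fun r hr => ?_
    rw [Set.uIcc_of_le zero_le_one] at hr
    have : r ^ 2 ≤ 1 := pow_le_one₀ hr.1 hr.2
    have e : (1 - (r : ℂ) ^ 2) = ((1 - r ^ 2 : ℝ) : ℂ) := by push_cast; rfl
    simp only [mul_zero, zero_div, sub_zero, Complex.sqrt_one, div_one]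
    rw [e, Complex.sqrt_of_nonneg (Complex.zero_le_real.2 (by linarith)), Complex.ofReal_re]

theorem hasStrictDerivAt_mul_tipIntegral :
    HasStrictDerivAt (fun a => a * tipIntegral a) (tipIntegral 0) 0 := by
  have hd : ∀ a : ℂ, ‖a‖ < 1 → DifferentiableAt ℂ (fun a => a * tipIntegral a) a := fun a ha =>
    differentiableAt_id.fun_mul (differentiableAt_tipIntegral ha)
  have han : AnalyticAt ℂ (fun a => a * tipIntegral a) 0 := by
    refine DifferentiableOn.analyticAt (s := Metric.ball 0 1)
      (fun a ha => (hd a (by simpa using ha)).differentiableWithinAt) (Metric.ball_mem_nhds 0 one_pos)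
  have h1 := (hasDerivAt_id' (0 : ℂ)).fun_mul (differentiableAt_tipIntegral (by simp)).hasDerivAt
  have h2 := han.hasStrictDerivAt
  rw [h1.deriv] at h2
  simpa using h2

/-- A local inverse of `a ↦ a * tipIntegral a`. -/
theorem exists_tip_inverse : ∃ (c ρ : ℝ) (g : ℂ → ℂ), 0 < c ∧ 0 < ρ ∧ g 0 = 0 ∧
    (∀ y, ‖y‖ ≤ ρ → g y * tipIntegral (g y) = y) ∧ (∀ y, ‖y‖ ≤ ρ → ContinuousAt g y) ∧
    ∀ y, ‖y‖ ≤ ρ → ‖g y - y / c‖ ≤ ‖y‖ / (4 * c) := by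
  obtain ⟨c, hc, hc'⟩ := exists_tipIntegral_zero
  have hF := hasStrictDerivAt_mul_tipIntegral
  rw [hc'] at hF
  have hc0 : (c : ℂ) ≠ 0 := by exact_mod_cast hc.ne'
  set g := hF.localInverse (fun a => a * tipIntegral a) c 0 hc0 with hg
  have h1 : HasStrictDerivAt g (c : ℂ)⁻¹ 0 := by
    simpa using hF.to_localInverse hc0
  have h2 : ∀ᶠ y in 𝓝 (0 : ℂ), g y * tipIntegral (g y) = y := by
    have := HasStrictFDerivAt.eventually_right_inverse (hF.hasStrictFDerivAt_equiv hc0)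
    simpa using this
  have h3 : g 0 = 0 := by
    have := HasStrictFDerivAt.localInverse_apply_image (hF.hasStrictFDerivAt_equiv hc0)
    simpa using this
  have h4 : ∀ᶠ y in 𝓝 (0 : ℂ), ‖g y - y / c‖ ≤ ‖y‖ / (4 * c) := by
    have := (hasDerivAt_iff_isLittleO.1 h1.hasDerivAt).def (c := 1 / (4 * c)) (by positivity)
    filter_upwards [this] with y hy
    rw [h3, sub_zero, sub_zero, smul_eq_mul, ← div_eq_mul_inv] at hy
    rw [div_eq_mul_one_div ‖y‖, mul_comm ‖y‖]; exact hy
  -- Strict differentiability makes the inverse Lipschitz near `0`, which yields continuity at all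
  -- nearby points and not just at `0`.
  obtain ⟨K, s, hs, hK⟩ := h1.hasStrictFDerivAt.exists_lipschitzOnWith
  obtain ⟨ρ, hρ, hb⟩ := Metric.eventually_nhds_iff_ball.1
    (h2.and (h4.and (eventually_mem_nhds_iff.2 hs)))
  have hmem : ∀ y : ℂ, ‖y‖ ≤ ρ / 2 → y ∈ Metric.ball 0 ρ := fun y hy => by
    rw [mem_ball_zero_iff]; linarith
  exact ⟨c, ρ / 2, g, hc, by positivity, h3, fun y hy => (hb y (hmem y hy)).1,
    fun y hy => hK.continuousOn.continuousAt (hb y (hmem y hy)).2.2,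
    fun y hy => (hb y (hmem y hy)).2.1⟩

/-- The value `a = 0` is included because it is an endpoint for the intermediate value theorem. -/
theorem continuousAt_quarterIntegral {a : ℂ} (ha : 0 < a.im ∨ a = 0) :
    ContinuousAt quarterIntegral a := by
  refine continuousAt_intervalIntegral_param
    (F := fun a τ => (4 * (Real.sin τ : ℂ) ^ 2 + a).sqrt)
    (fun a => Complex.measurable_sqrt.comp (by fun_prop)) fun τ _ => ?_
  refine ContinuousAt.comp (f := fun p : ℂ × ℝ => 4 * (Real.sin p.2 : ℂ) ^ 2 + p.1) (x := (a, τ))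
    (Complex.continuousAt_sqrt ?_) (by fun_prop)
  rw [four_mul_ofReal_sq_add_re, four_mul_ofReal_sq_add_im]
  rcases ha with ha | rfl
  · exact .inr ha.ne'
  · left; simp only [Complex.zero_re]; positivity

theorem quarterIntegral_im_pos {a : ℂ} (ha : 0 < a.im) : 0 < (quarterIntegral a).im := by
  have hc : Continuous fun τ : ℝ => (4 * (Real.sin τ : ℂ) ^ 2 + a).sqrt := by
    refine continuous_iff_continuousAt.2 fun τ => ?_
    exact ContinuousAt.comp (f := fun τ : ℝ => 4 * (Real.sin τ : ℂ) ^ 2 + a)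
      (Complex.continuousAt_sqrt (.inr (by rw [four_mul_ofReal_sq_add_im]; exact ha.ne')))
      (by fun_prop)
  rw [quarterIntegral, intervalIntegral_im (hc.intervalIntegrable _ _)]
  exact intervalIntegral.intervalIntegral_pos_of_pos
    ((Complex.continuous_im.comp hc).intervalIntegrable _ _)
    (fun τ => Complex.im_sqrt_pos (by rwa [four_mul_ofReal_sq_add_im])) (by positivity)

theorem exists_quarterIntegral_zero : ∃ c : ℝ, 0 < c ∧ quarterIntegral 0 = c := by
  refine ⟨∫ τ in (0 : ℝ)..(Real.pi / 2), √(4 * Real.sin τ ^ 2), ?_, ?_⟩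
  · refine intervalIntegral.integral_pos (by positivity) (by fun_prop)
      (fun t _ => Real.sqrt_nonneg _) ⟨Real.pi / 2, ⟨by positivity, le_rfl⟩, ?_⟩
    rw [Real.sin_pi_div_two]; norm_num
  · rw [← intervalIntegral.integral_ofReal]
    refine intervalIntegral.integral_congr fun τ _ => ?_
    have e : (4 * (Real.sin τ : ℂ) ^ 2 + 0) = ((4 * Real.sin τ ^ 2 : ℝ) : ℂ) := by push_cast; ring
    simp only [e]
    rw [Complex.sqrt_of_nonneg (Complex.zero_le_real.2 (by positivity)), Complex.ofReal_re]

/-- Along the curve `a = g(y)` the remaining function `E φ s` equals `k sin φ < 0` at `s = 0`. At `s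
= ρ` it is positive for `φ = 0`, hence for `φ` near `0`. -/
theorem exists_periodConditions : ∀ᶠ φ : ℝ in 𝓝[<] 0, ∃ a, PeriodConditions φ a := by
  obtain ⟨c, ρ, g, hc, hρ, hg0, hFg, hgc, hgd⟩ := exists_tip_inverse
  obtain ⟨k, hk, hk'⟩ := exists_quarterIntegral_zero
  -- Chosen so that `e^{iφ} y = i s`: the tip equation then holds identically for `a = g(y)`.
  set y : ℝ → ℝ → ℂ := fun φ s => Complex.exp (-φ * Complex.I) * (Complex.I * s) with hy
  have hyn : ∀ φ s, 0 ≤ s → ‖y φ s‖ = s := fun φ s hs => by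
    simp only [hy]
    rw [norm_mul, norm_mul, Complex.norm_I, one_mul, Complex.norm_of_nonneg hs,
      ← Complex.ofReal_neg, Complex.norm_exp_ofReal_mul_I, one_mul]
  have hyim : ∀ φ s, (y φ s).im = Real.cos φ * s := fun φ s => by
    simp only [hy]
    rw [← Complex.ofReal_neg, Complex.im_exp_mul, Complex.I_mul_im, Complex.I_mul_re]
    simp
  -- The error bound `|y| / (4c)` on `g` is half of the lower bound `s / (2c)` for `Im (y / c)`.
  have hpos : ∀ φ s, 1 / 2 ≤ Real.cos φ → 0 < s → s ≤ ρ → 0 < (g (y φ s)).im := by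
    intro φ s hφ hs hsρ
    have h1 := (Complex.abs_im_le_norm _).trans (hgd (y φ s) (by rwa [hyn φ s hs.le]))
    rw [hyn φ s hs.le, Complex.sub_im, Complex.div_ofReal_im, hyim] at h1
    have h2 := neg_le_of_abs_le h1
    have h3 : 1 / 2 * s / c ≤ Real.cos φ * s / c := by gcongr
    have h4 : 1 / 2 * s / c = 2 * (s / (4 * c)) := by field_simp; norm_num
    have h5 : 0 < s / (4 * c) := by positivity
    linarith
  set E : ℝ → ℝ → ℝ := fun φ s =>
    (Complex.exp (φ * Complex.I) * quarterIntegral (g (y φ s))).im with hE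
  have hcosev : ∀ᶠ φ : ℝ in 𝓝 0, 1 / 2 ≤ Real.cos φ := by
    refine (Real.continuous_cos.continuousAt.eventually_const_lt (u := 1 / 2) ?_).mono
      fun _ h => h.le
    rw [Real.cos_zero]; norm_num
  have hcontφ : ContinuousAt (fun φ => E φ ρ) 0 := by
    have h1 : ContinuousAt quarterIntegral (g (y 0 ρ)) :=
      continuousAt_quarterIntegral (.inl (hpos 0 ρ (by rw [Real.cos_zero]; norm_num) hρ le_rfl))
    have h2 : ContinuousAt (fun φ => y φ ρ) 0 := by simp only [hy]; fun_prop
    have h3 : ContinuousAt (fun φ => quarterIntegral (g (y φ ρ))) 0 :=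
      ContinuousAt.comp (f := fun φ => g (y φ ρ)) h1
        (ContinuousAt.comp (f := fun φ => y φ ρ) (hgc _ (by rw [hyn 0 ρ hρ.le])) h2)
    exact Complex.continuous_im.continuousAt.comp (ContinuousAt.mul (by fun_prop) h3)
  have hE0 : 0 < E 0 ρ := by
    simp only [hE]
    rw [Complex.im_exp_mul, Real.cos_zero, Real.sin_zero, one_mul, zero_mul, add_zero]
    exact quarterIntegral_im_pos (hpos 0 ρ (by rw [Real.cos_zero]; norm_num) hρ le_rfl)
  have hpi : -Real.pi < 0 := by linarith [Real.pi_pos]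
  filter_upwards [nhdsWithin_le_nhds hcosev,
    nhdsWithin_le_nhds (hcontφ.eventually_const_lt hE0), Ioo_mem_nhdsLT hpi] with φ hcos hEρ hφ
  have hcont : ContinuousOn (E φ) (Set.Icc 0 ρ) := by
    intro s hs
    have h1 : ContinuousAt quarterIntegral (g (y φ s)) := by
      refine continuousAt_quarterIntegral ?_
      rcases hs.1.eq_or_lt with rfl | h0
      · right; simp [hy, hg0]
      · exact .inl (hpos φ s hcos h0 hs.2)
    have h2 : ContinuousAt (fun s => y φ s) s := by simp only [hy]; fun_prop
    have h3 : ContinuousAt (fun s => quarterIntegral (g (y φ s))) s :=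
      ContinuousAt.comp (f := fun s => g (y φ s)) h1
        (ContinuousAt.comp (f := fun s => y φ s) (hgc _ (by rw [hyn φ s hs.1]; exact hs.2)) h2)
    exact (Complex.continuous_im.continuousAt.comp
      (continuousAt_const.mul h3)).continuousWithinAt
  have hφ0 : E φ 0 < 0 := by
    simp only [hE, hy, Complex.ofReal_zero, mul_zero, hg0, hk']
    rw [Complex.im_exp_mul, Complex.ofReal_im, Complex.ofReal_re, mul_zero, zero_add]
    exact mul_neg_of_neg_of_pos (Real.sin_neg_of_neg_of_neg_pi_lt hφ.2 hφ.1) hk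
  obtain ⟨s, hs, hs0⟩ := intermediate_value_Icc hρ.le hcont ⟨hφ0.le, hEρ.le⟩
  have hspos : 0 < s := lt_of_le_of_ne hs.1 (by rintro rfl; linarith)
  have ha := hpos φ s hcos hspos hs.2
  refine ⟨g (y φ s), ha, chartImSq_tip_eq_zero (ne_zero_of_im_pos ha) ?_, hs0⟩
  rw [hFg _ (by rw [hyn φ s hs.1]; exact hs.2)]
  simp only [hy]
  rw [← mul_assoc, ← Complex.exp_add, neg_mul, add_neg_cancel, Complex.exp_zero, one_mul]
  simp

theorem exists_solvesBoutroux : ∀ᶠ φ : ℝ in 𝓝[≠] 0, ∃ A : ℂ, SolvesBoutroux φ A := by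
  have h1 : ∀ᶠ φ : ℝ in 𝓝[<] 0, ∃ A : ℂ, SolvesBoutroux φ A :=
    exists_periodConditions.mono fun φ ⟨a, ha⟩ => ⟨_, ha.solvesBoutroux⟩
  have h2 : ∀ᶠ φ : ℝ in 𝓝[>] 0, ∃ A : ℂ, SolvesBoutroux φ A := by
    have hneg : Tendsto (fun φ : ℝ => -φ) (𝓝[>] 0) (𝓝[<] 0) := by
      simpa using tendsto_neg_nhdsGT (a := (0 : ℝ))
    filter_upwards [hneg.eventually h1] with φ ⟨A, hA⟩
    exact ⟨starRingEnd ℂ A, by simpa using hA.conj⟩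
  rw [← nhdsLT_sup_nhdsGT]
  exact eventually_sup.2 ⟨h1, h2⟩

/-! ### The asymptotics of the branch points -/

theorem proposition8p16 :
    (∀ᶠ φ : ℝ in 𝓝[≠] 0, ∃ A : ℂ, SolvesBoutroux φ A) ∧
    ∀ (A l₁ l₂ : ℝ → ℂ),
      (∀ᶠ φ : ℝ in 𝓝[≠] 0, SolvesBoutroux φ (A φ)) →
      (∀ᶠ φ : ℝ in 𝓝[≠] 0, IsBranchPair (A φ) (l₁ φ) (l₂ φ)) →
      ∃ ε θ : ℝ → ℝ,
        (fun φ : ℝ => l₁ φ - (1 - ε φ * Complex.exp (θ φ * Complex.I)))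
          =O[𝓝[≠] 0] (fun φ : ℝ => ε φ ^ 2) ∧
        (fun φ : ℝ => l₂ φ - (1 + ε φ * Complex.exp (θ φ * Complex.I)))
          =O[𝓝[≠] 0] (fun φ : ℝ => ε φ ^ 2) ∧
        (∀ᶠ φ : ℝ in 𝓝[≠] 0, 0 < ε φ) ∧
        Tendsto ε (𝓝[≠] 0) (𝓝 0) ∧
        Tendsto θ (𝓝[<] 0) (𝓝 (Real.pi / 4)) ∧
        Tendsto θ (𝓝[>] 0) (𝓝 (-(Real.pi / 4))) := by
  refine ⟨exists_solvesBoutroux, fun A l₁ l₂ hA hl => ?_⟩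
  obtain ⟨a, rfl⟩ : ∃ a : ℝ → ℂ, A = fun φ => a φ + 2 := ⟨fun φ => A φ - 2, by simp⟩
  have hlim := tendsto_of_solvesBoutroux hA
  obtain ⟨-, hargl⟩ := tendsto_of_solvesBoutroux_left hA
  obtain ⟨-, hargr⟩ := tendsto_of_solvesBoutroux_right hA
  have himl := eventually_im_pos_of_solvesBoutroux hA
  have himr := eventually_im_neg_of_solvesBoutroux hA
  have him : ∀ᶠ φ in 𝓝[≠] (0 : ℝ), (a φ).im ≠ 0 := by
    rw [← nhdsLT_sup_nhdsGT]
    exact eventually_sup.2 ⟨himl.mono fun _ h => h.ne', himr.mono fun _ h => h.ne⟩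
  have hmul : ∀ᶠ φ in 𝓝[≠] (0 : ℝ), l₁ φ * l₂ φ = 1 := by
    filter_upwards [hl, hlim.norm.eventually_lt_const (u := 1) (by simp)] with φ h1 h2
      using h1.mul_eq_one h2
  have harg : ∀ᶠ φ in 𝓝[≠] (0 : ℝ), (a φ).arg / 2 = (l₂ φ - l₁ φ).arg := by
    filter_upwards [hl, hmul, him] with φ h1 h2 h3 using (h1.arg_sub h2 h3).symm
  have hpolar : ∀ φ, ((‖l₂ φ - l₁ φ‖ / 2 : ℝ) : ℂ) *
      Complex.exp ((l₂ φ - l₁ φ).arg * Complex.I) = (l₂ φ - l₁ φ) / 2 := fun φ => by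
    rw [Complex.ofReal_div, div_mul_eq_mul_div, Complex.norm_mul_exp_arg_mul_I]
    norm_num
  have hbound : ∀ᶠ φ in 𝓝[≠] (0 : ℝ), ‖(l₁ φ + l₂ φ) / 2 - 1‖ ≤
      1 * ‖(‖l₂ φ - l₁ φ‖ / 2) ^ 2‖ := by
    filter_upwards [hl, hmul] with φ h1 h2
    rw [one_mul, Real.norm_of_nonneg (sq_nonneg _)]
    exact h1.norm_half_add_sub_one_le h2
  -- Polar coordinates of half the difference. Both error terms then equal the midpoint minus `1`.
  refine ⟨fun φ => ‖l₂ φ - l₁ φ‖ / 2, fun φ => (l₂ φ - l₁ φ).arg, ?_, ?_, ?_, ?_, ?_, ?_⟩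
  · refine IsBigO.of_bound 1 (hbound.mono fun φ h => ?_)
    rw [hpolar]
    convert h using 2
    ring
  · refine IsBigO.of_bound 1 (hbound.mono fun φ h => ?_)
    rw [hpolar]
    convert h using 2
    ring
  · filter_upwards [hl, hmul, him] with φ h1 h2 h3
    have : l₂ φ - l₁ φ ≠ 0 := fun h0 => h3 (by rw [← h1.sub_sq h2, h0]; simp)
    positivity
  · have h1 : Tendsto (fun φ => √‖a φ‖ / 2) (𝓝[≠] 0) (𝓝 0) := by
      simpa using hlim.norm.sqrt.div_const 2
    refine h1.congr' ?_
    filter_upwards [hl, hmul] with φ h1 h2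
    rw [← h1.sub_sq h2, norm_pow, Real.sqrt_sq (norm_nonneg _)]
  · have h1 := hargl.div_const 2
    rw [show Real.pi / 2 / 2 = Real.pi / 4 by ring] at h1
    exact h1.congr' (harg.filter_mono (nhdsWithin_mono 0 fun x (hx : x < 0) => hx.ne))
  · have h1 := hargr.div_const 2
    rw [show -(Real.pi / 2) / 2 = -(Real.pi / 4) by ring] at h1
    exact h1.congr' (harg.filter_mono (nhdsWithin_mono 0 fun x (hx : 0 < x) => hx.ne'))
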